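/- For a finite connected graph $G=(V,E)$, a local antimagic labeling is a bijection $f:E\to\{1,\dots,|E|\}$ such that $f^+(x)\ne f^+(y)$ for all adjacent $x,y$, where $f^+(x)$ is the sum of $f(e)$ over the edges $e$ incident to $x$; $\chi_{la}(G)$ is the least number of distinct values of $f^+$ over all such labelings. $C_m(a_0,\dots,a_k)$ denotes the circulant graph on $\mathbb Z_m$ in which $u,v$ are adjacent iff $u-v\equiv\pm a_i \pmod m$ for some $i$. A one-point union is obtained by merging one chosen vertex of each of the given graphs (vertex $0$ for a circulant graph on $\mathbb Z_m$). For $n\equiv 0\pmod 4$, let $\mathcal G_n$ be the set of all simple graphs of order $n/2$ that arise from the cycle $v_0v_1\cdots v_{n-1}$ by partitioning its even-indexed vertices into pairs and its odd-indexed vertices into pairs and merging the two vertices of each pair, where no multiple edges arise; the chosen vertex is the one containing $v_0$. **Theorem.** There are infinitely many pairwise non-isomorphic one-point unions of regular graphs, with all copies, except possibly one, circulant, that have $\chi_{la}=2$. More precisely, each of the following graphs is connected and has $\chi_{la}=2$. (A) For odd $r\ge 9$: the one-point union of $C_{4r-2}(1,a_h)$, $1\le h\le \frac{r-1}2$, and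 $H$, for any integers $1<a_h<2r-1$ with $\gcd(a_h,4r-2)=1$ and any $H\in\mathcal G_{2r-2}$. (B) For $r\equiv 1\pmod 4$, $r\ge 9$: the one-point union of $C_{2r}(1,a_h)$, $C_{2r-2}(1,b_h)$, $1\le h\le\frac{r-1}4$, and $H$, for any integers $1<a_h<r$ with $\gcd(a_h,2r)=1$, $1<b_h<r-1$ with $\gcd(b_h,2r-2)=1$, and any $H\in\mathcal G_{2r-2}$. For $s\ge 2$, $t\ge 0$ put $r=2^{2s-2}(t+2)+1$ and $K_{s,t}=C_{2^s(t+2)}(J)$ with $J=\{1+l(2t+4),\,2t+3+l(2t+4): 0\le l<2^{s-2}\}$. For an integer $m$, a jump set for $m$ is a set of $2^{s-1}$ positive integers that are smaller than $m/2$ and coprime to $m$, one of which is $1$. (C) The one-point union of $K_{s,t}$ and $C_{4r-2}(S_h)$, $1\le h\le 2^{s-1}(t+2)$, for any jump sets $S_h$ for $4r-2$. (D) The one-point union of $K_{s,t}$, $C_{2r}(S_h)$ and $C_{2r-2}(T_h)$, $1\le h\le 2^{s-2}(t+2)$, for any jump sets $S_h$ for $2r$ and $T_h$ for $2r-2$.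 In (A) and (B) the graph is a one-point union of at least two connected $4$-regular bipartite graphs, at most one of which is not circulant; in (C) and (D) it is a one-point union of at least two connected $2^s$-regular bipartite circulant graphs. The families (A) and (B) are non-empty for each such $r$; each of the families (A) and (B), and for every fixed $s\ge 2$ each of the families (C) and (D), contains infinitely many pairwise non-isomorphic graphs. -/

import Mathlib

namespace LocalAntimagic

/-! ### Local antimagic labelings -/

/-- The induced vertex label `f⁺(v)`: the sum of `f(e)` over the edges `e` incident to `v`. -/
noncomputable def vertexLabel {V : Type} (G : SimpleGraph V) (f : Sym2 V → ℕ) (v : V) : ℕ :=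
  ∑ᶠ e ∈ G.incidenceSet v, f e

/-- `f` restricts to a bijection `E(G) → {1, …, |E(G)|}` and adjacent vertices have distinct
induced labels. (The values of `f` off the edge set play no role.) -/
def IsLocalAntimagic {V : Type} (G : SimpleGraph V) (f : Sym2 V → ℕ) : Prop :=
  Set.BijOn f G.edgeSet (Set.Icc 1 G.edgeSet.ncard) ∧
    ∀ u v, G.Adj u v → vertexLabel G f u ≠ vertexLabel G f v

/-- The colour number `c(f)`: the number of distinct induced vertex labels. -/
noncomputable def colorNumber {V : Type} (G : SimpleGraph V) (f : Sym2 V → ℕ) : ℕ :=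
  (Set.range (vertexLabel G f)).ncard

/-- The local antimagic chromatic number `χ_la(G)` (with the value `0` if there is no
local antimagic labeling). -/
noncomputable def chiLa {V : Type} (G : SimpleGraph V) : ℕ :=
  sInf {c | ∃ f, IsLocalAntimagic G f ∧ colorNumber G f = c}

/-! ### One-point unions -/

/-- A graph with a chosen vertex. -/
structure RootedGraph where
  V : Type
  graph : SimpleGraph V
  root : V

/-- Vertices of the one-point union: the merged vertex `none`, and all non-root vertices. -/
abbrev UnionVertex {ι : Type} (H : ι → RootedGraph) : Type :=
  Option (Σ i, {v : (H i).V // v ≠ (H i).root})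

open Classical in
/-- The map of the `i`-th block into the one-point union; the root goes to the merged vertex. -/
noncomputable def blockMap {ι : Type} (H : ι → RootedGraph) (i : ι) (v : (H i).V) :
    UnionVertex H :=
  if h : v = (H i).root then none else some ⟨i, v, h⟩

/-- The one-point union: the disjoint union of the blocks `H i` with all the roots merged. -/
noncomputable def onePointUnion {ι : Type} (H : ι → RootedGraph) : RootedGraph where
  V := UnionVertex H
  graph := ⨆ i, (H i).graph.map (blockMap H i)
  root := none

/-! ### Circulant graphs and transformations of cycles -/

/-- The circulant graph `C_m(a : a ∈ S)` on `ℤ/m`, rooted at the vertex `0`. -/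
def circulant (m : ℕ) (S : Finset ℕ) : RootedGraph where
  V := ZMod m
  graph := SimpleGraph.circulantGraph ((fun a : ℕ => (a : ZMod m)) '' (S : Set ℕ))
  root := 0

/-- A graph is circulant if it is isomorphic to a circulant graph on some finite `ℤ/m`. -/
def IsCirculant {V : Type} (G : SimpleGraph V) : Prop :=
  ∃ m : ℕ, 1 ≤ m ∧ ∃ S : Set (ZMod m), Nonempty (G ≃g SimpleGraph.circulantGraph S)

/-- A partition of the vertices `v_0, …, v_{n-1}` of the cycle `C_n` into blocks of size two, each
consisting of two vertices with even subscripts or of two vertices with odd subscripts. -/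
def IsParityPairing (n : ℕ) (P : Setoid (ZMod n)) : Prop :=
  (∀ x : ZMod n, {y | P x y}.ncard = 2) ∧ ∀ x y : ZMod n, P x y → x.val % 2 = y.val % 2

/-- The graph obtained from the cycle `C_n` by merging the vertices in each block of `P`,
rooted at the vertex that contains `v_0`. -/
def mergedCycle (n : ℕ) (P : Setoid (ZMod n)) : RootedGraph where
  V := Quotient P
  graph := (circulant n {1}).graph.map (Quotient.mk P)
  root := Quotient.mk P (0 : ZMod n)

/-- Merging the blocks of `P` in `C_n` produces neither loops nor multiple edges. -/
def MergesSimply (n : ℕ) (P : Setoid (ZMod n)) : Prop :=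
  (∀ x y : ZMod n, (circulant n {1}).graph.Adj x y → ¬ P x y) ∧
    Set.InjOn (Sym2.map (Quotient.mk P)) (circulant n {1}).graph.edgeSet

/-- The jumps `1, 2t+3, 2t+5, 4t+7, …, 1+(2^(s-2)-1)(2t+4), 2t+3+(2^(s-2)-1)(2t+4)`. -/
def jumps (s t : ℕ) : Finset ℕ :=
  (Finset.range (2 ^ (s - 2))).image (fun l => 1 + l * (2 * t + 4)) ∪
    (Finset.range (2 ^ (s - 2))).image (fun l => 2 * t + 3 + l * (2 * t + 4))

/-- `S = {1, a_1, …, a_(q-1)}` has exactly `q` elements, all of them coprime to `m` and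
smaller than `m / 2`. -/
def IsJumpSet (m q : ℕ) (S : Finset ℕ) : Prop :=
  S.card = q ∧ 1 ∈ S ∧ ∀ a ∈ S, 2 * a < m ∧ Nat.Coprime a m

/-! ### The transformed one-point unions of cycles -/

/-- The graphs obtained from `U((4r-2)^[r-1], 2r-2)`: pairs of cycles `C_(4r-2)` become circulants
`C_(4r-2)(1, a_h)`, and `C_(2r-2)` becomes a simple graph by merging its vertices in pairs. -/
def familyA (r : ℕ) : Set RootedGraph :=
  {G | ∃ (a : Fin ((r - 1) / 2) → ℕ) (P : Setoid (ZMod (2 * r - 2))),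
    (∀ h, 1 < a h ∧ a h < 2 * r - 1 ∧ Nat.Coprime (a h) (4 * r - 2)) ∧
    IsParityPairing (2 * r - 2) P ∧ MergesSimply (2 * r - 2) P ∧
    G = onePointUnion (fun i : Option (Fin ((r - 1) / 2)) =>
      i.elim (mergedCycle (2 * r - 2) P) (fun h => circulant (4 * r - 2) {1, a h}))}

/-- The graphs obtained from `U((2r)^[(r-1)/2], (2r-2)^[(r+1)/2])`: pairs of cycles `C_(2r)` become
circulants `C_(2r)(1, a_h)`, pairs of cycles `C_(2r-2)` become circulants `C_(2r-2)(1, b_h)`, and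
the remaining `C_(2r-2)` becomes a simple graph by merging its vertices in pairs. -/
def familyB (r : ℕ) : Set RootedGraph :=
  {G | ∃ (a b : Fin ((r - 1) / 4) → ℕ) (P : Setoid (ZMod (2 * r - 2))),
    (∀ h, 1 < a h ∧ a h < r ∧ Nat.Coprime (a h) (2 * r)) ∧
    (∀ h, 1 < b h ∧ b h < r - 1 ∧ Nat.Coprime (b h) (2 * r - 2)) ∧
    IsParityPairing (2 * r - 2) P ∧ MergesSimply (2 * r - 2) P ∧
    G = onePointUnion (fun i : Option (Fin ((r - 1) / 4) ⊕ Fin ((r - 1) / 4)) =>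
      i.elim (mergedCycle (2 * r - 2) P)
        (Sum.elim (fun h => circulant (2 * r) {1, a h})
          (fun h => circulant (2 * r - 2) {1, b h})))}

/-- The graphs obtained from `U((4r-2)^[r-1], 2r-2)`, where `r = 2^(2s-2)(t+2)+1`: groups of
`2^(s-1)` cycles `C_(4r-2)` become `2^s`-regular circulants of order `4r-2`, and `C_(2r-2)` becomes
a `2^s`-regular circulant of order `2^s(t+2)`. -/
def familyC (s t r : ℕ) : Set RootedGraph :=
  {G | r = 2 ^ (2 * s - 2) * (t + 2) + 1 ∧ ∃ S : Fin (2 ^ (s - 1) * (t + 2)) → Finset ℕ,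
    (∀ h, IsJumpSet (4 * r - 2) (2 ^ (s - 1)) (S h)) ∧
    G = onePointUnion (fun i : Option (Fin (2 ^ (s - 1) * (t + 2))) =>
      i.elim (circulant (2 ^ s * (t + 2)) (jumps s t)) (fun h => circulant (4 * r - 2) (S h)))}

/-- The graphs obtained from `U((2r)^[(r-1)/2], (2r-2)^[(r+1)/2])`, where `r = 2^(2s-2)(t+2)+1`:
groups of `2^(s-1)` cycles `C_(2r)`, and groups of `2^(s-1)` cycles `C_(2r-2)`, become `2^s`-regular
circulants of orders `2r` and `2r-2`, and the remaining `C_(2r-2)` becomes a `2^s`-regular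
circulant of order `2^s(t+2)`. -/
def familyD (s t r : ℕ) : Set RootedGraph :=
  {G | r = 2 ^ (2 * s - 2) * (t + 2) + 1 ∧
    ∃ S T : Fin (2 ^ (s - 2) * (t + 2)) → Finset ℕ,
    (∀ h, IsJumpSet (2 * r) (2 ^ (s - 1)) (S h)) ∧
    (∀ h, IsJumpSet (2 * r - 2) (2 ^ (s - 1)) (T h)) ∧
    G = onePointUnion (fun i : Option
        (Fin (2 ^ (s - 2) * (t + 2)) ⊕ Fin (2 ^ (s - 2) * (t + 2))) =>
      i.elim (circulant (2 ^ s * (t + 2)) (jumps s t))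
        (Sum.elim (fun h => circulant (2 * r) (S h)) (fun h => circulant (2 * r - 2) (T h))))}

/-! ### The properties that are claimed -/

/-- `G` is (isomorphic to) a one-point union of at least two finite connected `d`-regular bipartite
graphs, of which at most `c` are not circulant. -/
def IsRegularUnion (d c : ℕ) (G : RootedGraph) : Prop :=
  ∃ (ι : Type) (H : ι → RootedGraph), Finite ι ∧ Nontrivial ι ∧
    (∀ i, Finite (H i).V ∧ (H i).graph.Connected ∧ (H i).graph.IsBipartite ∧
      ∀ v, ((H i).graph.neighborSet v).ncard = d) ∧
    {i | ¬ IsCirculant (H i).graph}.ncard ≤ c ∧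
    Nonempty (G.graph ≃g (onePointUnion H).graph)

/-- `G` is a finite connected graph with `χ_la(G) = 2`. -/
def HasChiLaTwo (G : RootedGraph) : Prop :=
  Finite G.V ∧ G.graph.Connected ∧ chiLa G.graph = 2

/-- The set `F` contains infinitely many pairwise non-isomorphic graphs. -/
def InfinitelyMany (F : Set RootedGraph) : Prop :=
  ∃ G : ℕ → RootedGraph, (∀ k, G k ∈ F) ∧
    Pairwise (fun i j => IsEmpty ((G i).graph ≃g (G j).graph))

end LocalAntimagic

/-!
Decompose a bipartite graph into closed trails from a common root, and label the edges such that
along every trail consecutive labels add up to `x` and `y` alternately, apart from the pair formed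
by the last and the first edge. A vertex `v ≠ root` that is visited `p` times then gets the vertex
label `p * x` or `p * y`, according to its colour class. If the first and last labels of all `k`
trails add up to `y`, then the root, visited `p + k - 1` times, gets the label
`(p - 1) * y + y = p * y` as well. The shape of the graph enters only through the lengths of its
trails, so it suffices to label the trails of lengths `4 r - 2` (`r - 1` times) and `2 r - 2`, or
`2 r` (`(r - 1) / 2` times) and `2 r - 2` (`(r + 1) / 2` times). This is done by arithmetic
progressions with a common difference at the even and at the odd positions, which together exhaust
all labels.
-/

namespace LocalAntimagic

theorem two_le_colorNumber {V : Type} [Finite V] {G : SimpleGraph V} {u v : V} (huv : G.Adj u v)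
    {f : Sym2 V → ℕ} (hf : IsLocalAntimagic G f) : 2 ≤ colorNumber G f := by
  rw [← Set.ncard_pair (hf.2 u v huv)]
  refine Set.ncard_le_ncard ?_ (Set.finite_range _)
  rintro _ (rfl | rfl) <;> exact ⟨_, rfl⟩

theorem chiLa_eq_two {V : Type} [Finite V] {G : SimpleGraph V} {u v : V} (huv : G.Adj u v)
    {f : Sym2 V → ℕ} (hf : IsLocalAntimagic G f) {x y : ℕ}
    (hxy : ∀ v, vertexLabel G f v = x ∨ vertexLabel G f v = y) : chiLa G = 2 := by
  have hcolor : colorNumber G f = 2 := by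
    refine le_antisymm ?_ (two_le_colorNumber huv hf)
    refine (Set.ncard_le_ncard ?_ (Set.toFinite {x, y})).trans <|
      (Set.ncard_insert_le x {y}).trans (by rw [Set.ncard_singleton])
    rintro _ ⟨v, rfl⟩
    exact hxy v
  refine le_antisymm (Nat.sInf_le ⟨f, hf, hcolor⟩) (le_csInf ⟨2, f, hf, hcolor⟩ ?_)
  rintro _ ⟨g, hg, rfl⟩
  exact two_le_colorNumber huv hg

/-- A family of closed walks in `G` that together use every edge exactly once. The walks are the
cycles of the permutation `next` of the set `Pos` of positions. -/
structure EdgeTraversal {V : Type} (G : SimpleGraph V) (Pos : Type) where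
  next : Equiv.Perm Pos
  vertex : Pos → V
  bijOn_edge : Set.BijOn (fun x => s(vertex x, vertex (next x))) Set.univ G.edgeSet

namespace EdgeTraversal

variable {V Pos : Type} {G : SimpleGraph V} (T : EdgeTraversal G Pos)

/-- The number of positions at which a traversal is at the vertex `v`; it is a junk value if there
are infinitely many. -/
noncomputable def visits (v : V) : ℕ := {x | T.vertex x = v}.ncard

theorem adj (x : Pos) : G.Adj (T.vertex x) (T.vertex (T.next x)) :=
  T.bijOn_edge.mapsTo (Set.mem_univ x)

theorem bijOn_incidenceSet (v : V) :
    Set.BijOn (fun x => s(T.vertex x, T.vertex (T.next x)))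
      {x | T.vertex x = v ∨ T.vertex (T.next x) = v} (G.incidenceSet v) := by
  refine ⟨fun x hx => ⟨T.adj x, ?_⟩, T.bijOn_edge.injOn.mono (Set.subset_univ _), fun e he => ?_⟩
  · rcases hx with hx | hx <;> simp [← hx]
  · obtain ⟨x, -, rfl⟩ := T.bijOn_edge.surjOn he.1
    exact ⟨x, (Sym2.mem_iff.mp he.2).imp Eq.symm Eq.symm, rfl⟩

theorem ncard_edgeSet {V Pos : Type} {G : SimpleGraph V} (T : EdgeTraversal G Pos) :
    G.edgeSet.ncard = Nat.card Pos := by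
  rw [← T.bijOn_edge.image_eq, T.bijOn_edge.injOn.ncard_image, Set.ncard_univ]

section Fintype

open Finset

variable [Fintype Pos] [DecidableEq V]

theorem card_filter_vertex_eq (v : V) : #{x | T.vertex x = v} = T.visits v := by
  rw [visits, ← Set.ncard_coe_finset, Finset.coe_filter_univ]

theorem vertexLabel_eq_sum (f : Sym2 V → ℕ) (v : V) :
    vertexLabel G f v = ∑ x with T.vertex x = v,
      (f s(T.vertex x, T.vertex (T.next x)) + f s(T.vertex (T.next.symm x), T.vertex x)) := by
  classical
  have hpos : {x | T.vertex x = v ∨ T.vertex (T.next x) = v} =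
      ↑(univ.filter (T.vertex · = v) ∪ univ.filter fun x => T.vertex (T.next x) = v) := by
    ext
    simp
  have hdisj : Disjoint (univ.filter (T.vertex · = v))
      (univ.filter fun x => T.vertex (T.next x) = v) :=
    Finset.disjoint_filter.mpr fun x _ hx hnext => (T.adj x).ne (hx.trans hnext.symm)
  rw [vertexLabel, ← finsum_mem_eq_of_bijOn _ (T.bijOn_incidenceSet v) fun _ _ => rfl, hpos,
    finsum_mem_coe_finset, Finset.sum_union hdisj, Finset.sum_add_distrib]
  congr 1
  exact Finset.sum_equiv T.next (by simp) (by simp)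

theorem exists_isLocalAntimagic {l : Pos → ℕ}
    (hl : Set.BijOn l Set.univ (Set.Icc 1 (Nat.card Pos))) {c : V → ℕ}
    (hc : ∀ u v, G.Adj u v → c u ≠ c v)
    (hsum : ∀ v, ∑ x with T.vertex x = v, (l x + l (T.next.symm x)) = c v) :
    ∃ f, IsLocalAntimagic G f ∧ vertexLabel G f = c := by
  have hinj := Set.injOn_univ.mp T.bijOn_edge.injOn
  set f := Function.extend (fun x => s(T.vertex x, T.vertex (T.next x))) l 0
  have hf_edge (x : Pos) : f s(T.vertex x, T.vertex (T.next x)) = l x := hinj.extend_apply l 0 x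
  have hlabel : vertexLabel G f = c := by
    ext v
    rw [T.vertexLabel_eq_sum, ← hsum]
    refine Finset.sum_congr rfl fun x _ => ?_
    have hprev := hf_edge (T.next.symm x)
    rw [Equiv.apply_symm_apply] at hprev
    rw [hf_edge, hprev]
  refine ⟨f, ⟨?_, fun u v huv => hlabel ▸ hc u v huv⟩, hlabel⟩
  rw [T.ncard_edgeSet, ← T.bijOn_edge.image_eq, ← Set.bijOn_comp_iff T.bijOn_edge.injOn]
  exact hl.congr fun x _ => (hf_edge x).symm

end Fintype

theorem ncard_neighborSet [Finite Pos] (v : V) : (G.neighborSet v).ncard = 2 * T.visits v := by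
  classical
  have := Fintype.ofFinite Pos
  have hfin : (G.incidenceSet v).Finite :=
    (T.bijOn_incidenceSet v).image_eq ▸ (Set.toFinite _).image _
  have hlabel : vertexLabel G (fun _ => 1) v = (G.incidenceSet v).ncard := by
    rw [vertexLabel, finsum_mem_eq_finite_toFinset_sum _ hfin, Finset.sum_const, smul_eq_mul,
      mul_one, Set.ncard_eq_toFinset_card _ hfin]
  rw [← Nat.card_coe_set_eq, ← Nat.card_congr (G.incidenceSetEquivNeighborSet v),
    Nat.card_coe_set_eq, ← hlabel, T.vertexLabel_eq_sum, Finset.sum_const, T.card_filter_vertex_eq,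
    smul_eq_mul, mul_comm]

theorem visits_eq_visits {Pos' : Type} [Finite Pos] [Finite Pos'] (T' : EdgeTraversal G Pos')
    (v : V) : T.visits v = T'.visits v := by
  have h := T.ncard_neighborSet v
  rw [T'.ncard_neighborSet] at h
  lia

end EdgeTraversal

/-- A decomposition of the edge set of a rooted graph into closed trails that start at the root.
The trail with index `j` has length `n j`. -/
structure TrailCover (Γ : RootedGraph) {J : Type} (n : J → ℕ) where
  walk : ∀ j, ZMod (n j) → Γ.V
  walk_zero : ∀ j, walk j 0 = Γ.root
  bijOn_edge : Set.BijOn (fun x : Σ j, ZMod (n j) => s(walk x.1 x.2, walk x.1 (x.2 + 1))) Set.univ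
    Γ.graph.edgeSet

namespace TrailCover

open Finset

variable {Γ Γ' : RootedGraph} {J : Type} {n : J → ℕ} (C : TrailCover Γ n)

/-- The traversal of the edges that follows the trails of a cover. -/
def toTraversal : EdgeTraversal Γ.graph (Σ j, ZMod (n j)) where
  next := Equiv.sigmaCongrRight fun _ => Equiv.addRight 1
  vertex x := C.walk x.1 x.2
  bijOn_edge := C.bijOn_edge

theorem toTraversal_next_symm (z : Σ j, ZMod (n j)) :
    C.toTraversal.next.symm z = ⟨z.1, z.2 - 1⟩ := by
  simp [toTraversal, sub_eq_add_neg]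

/-- The number of times that the trails pass through the vertex `v`. -/
noncomputable def visits (v : Γ.V) : ℕ := {x : Σ j, ZMod (n j) | C.walk x.1 x.2 = v}.ncard

theorem visits_toTraversal (v : Γ.V) : C.toTraversal.visits v = C.visits v := rfl

theorem card_filter_walk_eq [Fintype (Σ j, ZMod (n j))] [DecidableEq Γ.V] (v : Γ.V) :
    #{x : Σ j, ZMod (n j) | C.walk x.1 x.2 = v} = C.visits v :=
  C.toTraversal.card_filter_vertex_eq v

theorem exists_walk_eq {v : Γ.V} (hv : C.visits v ≠ 0) : ∃ j i, C.walk j i = v := by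
  obtain ⟨⟨j, i⟩, h⟩ := Set.nonempty_of_ncard_ne_zero hv
  exact ⟨j, i, h⟩

theorem adj_walk (j : J) (i : ZMod (n j)) : Γ.graph.Adj (C.walk j i) (C.walk j (i + 1)) :=
  C.toTraversal.adj ⟨j, i⟩

variable [∀ j, NeZero (n j)]

theorem finite [Finite J] (hC : ∀ v, C.visits v ≠ 0) : Finite Γ.V :=
  Finite.of_surjective C.toTraversal.vertex fun v => by
    obtain ⟨j, i, h⟩ := C.exists_walk_eq (hC v)
    exact ⟨⟨j, i⟩, h⟩

theorem reachable_walk (j : J) (i : ZMod (n j)) : Γ.graph.Reachable Γ.root (C.walk j i) := by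
  rw [← ZMod.natCast_zmod_val i]
  induction i.val with
  | zero => rw [Nat.cast_zero, C.walk_zero]
  | succ k ih =>
    rw [Nat.cast_succ]
    exact ih.trans (C.adj_walk j k).reachable

theorem connected (hC : ∀ v, C.visits v ≠ 0) : Γ.graph.Connected := by
  refine (SimpleGraph.connected_iff_exists_forall_reachable _).mpr ⟨Γ.root, fun v => ?_⟩
  obtain ⟨j, i, rfl⟩ := C.exists_walk_eq (hC v)
  exact C.reachable_walk j i

theorem coloring_walk_eq_iff (c : Γ.graph.Coloring Bool) (j : J) (i : ZMod (n j)) :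
    c (C.walk j i) = c Γ.root ↔ Even i.val := by
  suffices ∀ k : ℕ, c (C.walk j k) = c Γ.root ↔ Even k by
    simpa only [ZMod.natCast_zmod_val] using this i.val
  intro k
  induction k with
  | zero => simp [C.walk_zero]
  | succ k ih =>
    have hne := c.valid (C.adj_walk j k)
    rw [Nat.cast_succ, Nat.even_add_one, ← ih, Bool.eq_not.mpr hne.symm, Bool.not_eq]

omit [∀ j, NeZero (n j)]

/-- The image of a cover under a map of graphs that is bijective on edges. -/
def map (φ : Γ.V → Γ'.V) (hroot : φ Γ.root = Γ'.root)
    (hφ : Set.BijOn (Sym2.map φ) Γ.graph.edgeSet Γ'.graph.edgeSet) : TrailCover Γ' n where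
  walk j i := φ (C.walk j i)
  walk_zero j := by rw [C.walk_zero, hroot]
  bijOn_edge := hφ.comp C.bijOn_edge

theorem visits_map [Finite Γ.V] [Finite (Σ j, ZMod (n j))] {φ : Γ.V → Γ'.V}
    {hroot : φ Γ.root = Γ'.root} {hφ : Set.BijOn (Sym2.map φ) Γ.graph.edgeSet Γ'.graph.edgeSet}
    {p : ℕ} (hC : ∀ v, C.visits v = p) (v' : Γ'.V) :
    (C.map φ hroot hφ).visits v' = {v | φ v = v'}.ncard * p := by
  classical
  have := Fintype.ofFinite (Σ j, ZMod (n j))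
  have := Fintype.ofFinite Γ.V
  have hfiber (v : Γ.V) (hv : v ∈ ({v | φ v = v'} : Finset Γ.V)) :
      #{x ∈ {x : Σ j, ZMod (n j) | φ (C.walk x.1 x.2) = v'} | C.walk x.1 x.2 = v} = p := by
    rw [← hC v, ← C.card_filter_walk_eq, Finset.filter_filter]
    congr 1
    ext x
    simp only [Finset.mem_filter_univ] at hv ⊢
    exact ⟨And.right, fun h => ⟨h ▸ hv, h⟩⟩
  have hcard : #{x : Σ j, ZMod (n j) | φ (C.walk x.1 x.2) = v'} = #{v | φ v = v'} * p := by
    rw [Finset.card_eq_sum_card_fiberwise (t := {v | φ v = v'}) (f := fun x => C.walk x.1 x.2)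
      fun x hx => by simpa using hx, Finset.sum_congr rfl hfiber, Finset.sum_const, smul_eq_mul]
  rw [← card_filter_walk_eq, ← Finset.coe_filter_univ, Set.ncard_coe_finset]
  exact hcard

end TrailCover

section Union

variable {B : Type} {H : B → RootedGraph}

theorem blockMap_root (b : B) : blockMap H b (H b).root = none := by simp [blockMap]

theorem blockMap_eq_none_iff {b : B} {v : (H b).V} : blockMap H b v = none ↔ v = (H b).root := by
  simp [blockMap]

theorem blockMap_of_ne_root {b : B} {v : (H b).V} (hv : v ≠ (H b).root) :
    blockMap H b v = some ⟨b, v, hv⟩ :=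
  dif_neg hv

theorem blockMap_injective (b : B) : Function.Injective (blockMap H b) := by
  intro u v huv
  by_cases hu : u = (H b).root <;> by_cases hv : v = (H b).root <;>
    simp_all [blockMap]

theorem eq_of_blockMap_eq_blockMap {b b' : B} {v : (H b).V} {v' : (H b').V} (hv : v ≠ (H b).root)
    (h : blockMap H b v = blockMap H b' v') : b = b' := by
  by_cases hv' : v' = (H b').root
  · simp [hv', blockMap_root, blockMap_eq_none_iff, hv] at h
  · rw [blockMap_of_ne_root hv, blockMap_of_ne_root hv'] at h
    exact congrArg Sigma.fst (Option.some.inj h)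

theorem onePointUnion_adj {u v : UnionVertex H} : (onePointUnion H).graph.Adj u v ↔
    ∃ b u' v', (H b).graph.Adj u' v' ∧ blockMap H b u' = u ∧ blockMap H b v' = v := by
  change (⨆ b, (H b).graph.map (blockMap H b)).Adj u v ↔ _
  rw [SimpleGraph.iSup_adj]
  exact exists_congr fun b => SimpleGraph.map_adj ⟨_, blockMap_injective b⟩ _ _ _

theorem isBipartite_onePointUnion (hH : ∀ b, (H b).graph.IsBipartite) :
    (onePointUnion H).graph.IsBipartite := by
  let c (b : B) : (H b).graph.Coloring Bool := (hH b).toColoring (by simp)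
  let color (v : UnionVertex H) : Bool := v.elim false fun z => c z.1 z.2.1 ^^ c z.1 (H z.1).root
  have color_blockMap (b : B) (v : (H b).V) :
      color (blockMap H b v) = (c b v ^^ c b (H b).root) := by
    by_cases hv : v = (H b).root
    · simp [hv, blockMap_root, color]
    · rw [blockMap_of_ne_root hv]
      rfl
  refine (SimpleGraph.Coloring.mk color fun {u v} huv => ?_).colorable
  obtain ⟨b, u, v, h, rfl, rfl⟩ := onePointUnion_adj.mp huv
  have hne := (c b).valid h
  simpa only [color_blockMap, ne_eq, Bool.xor_left_inj] using hne

theorem eq_of_map_blockMap_eq {b b' : B} {e : Sym2 (H b).V} {e' : Sym2 (H b').V}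
    (he : e ∈ (H b).graph.edgeSet) (h : e.map (blockMap H b) = e'.map (blockMap H b')) :
    b = b' := by
  induction e with | _ u v
  have of_mem (z : (H b).V) (hz : z ∈ s(u, v)) (hne : z ≠ (H b).root) : b = b' := by
    obtain ⟨z', -, hz'⟩ := Sym2.mem_map.mp (h ▸ Sym2.mem_map.mpr ⟨z, hz, rfl⟩)
    exact eq_of_blockMap_eq_blockMap hne hz'.symm
  by_cases hu : u = (H b).root
  · exact of_mem v (by simp) fun hv => (SimpleGraph.ne_of_adj _ he) (hu.trans hv.symm)
  · exact of_mem u (by simp) hu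

namespace TrailCover

variable {J : B → Type} {n : ∀ b, J b → ℕ} (C : ∀ b, TrailCover (H b) (n b))

/-- The trails of the blocks form a cover of their one-point union. -/
noncomputable def onePointUnion :
    TrailCover (onePointUnion H) fun t : Σ b, J b => n t.1 t.2 where
  walk t i := blockMap H t.1 ((C t.1).walk t.2 i)
  walk_zero t := by rw [(C t.1).walk_zero, blockMap_root]; rfl
  bijOn_edge := by
    refine ⟨fun x _ => onePointUnion_adj.mpr ⟨_, _, _, (C x.1.1).adj_walk x.1.2 x.2, rfl, rfl⟩,
      ?_, fun e he => ?_⟩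
    · rintro ⟨⟨b, j⟩, i⟩ - ⟨⟨b', j'⟩, i'⟩ - h
      obtain rfl := eq_of_map_blockMap_eq (e := s(_, _)) (e' := s(_, _)) ((C b).adj_walk j i) h
      cases (C b).bijOn_edge.injOn (Set.mem_univ (⟨j, i⟩ : Σ j, ZMod (n b j)))
        (Set.mem_univ (⟨j', i'⟩ : Σ j, ZMod (n b j)))
        (Sym2.map.injective (blockMap_injective b) h)
      rfl
    · induction e with | _ u v
      obtain ⟨b, u, v, huv, rfl, rfl⟩ := onePointUnion_adj.mp he
      obtain ⟨⟨j, i⟩, -, h⟩ := (C b).bijOn_edge.surjOn ((SimpleGraph.mem_edgeSet _).mpr huv)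
      exact ⟨⟨⟨b, j⟩, i⟩, Set.mem_univ _, congrArg (Sym2.map (blockMap H b)) h⟩

theorem visits_onePointUnion_some {b : B} {v : (H b).V} (hv : v ≠ (H b).root) :
    (onePointUnion C).visits (some ⟨b, v, hv⟩ : UnionVertex H) = (C b).visits v := by
  have hinj : Function.Injective fun x : Σ j, ZMod (n b j) =>
      (⟨⟨b, x.1⟩, x.2⟩ : Σ t : Σ b, J b, ZMod (n t.1 t.2)) := by
    rintro ⟨j, i⟩ ⟨j', i'⟩ h
    cases h
    rfl
  refine Eq.trans (congrArg Set.ncard ?_) (Set.ncard_image_of_injective _ hinj)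
  ext ⟨⟨b', j⟩, i⟩
  change blockMap H b' ((C b').walk j i) = some ⟨b, v, hv⟩ ↔ _
  rw [← blockMap_of_ne_root hv]
  constructor
  · intro h
    obtain rfl := eq_of_blockMap_eq_blockMap hv h.symm
    exact ⟨⟨j, i⟩, blockMap_injective b h, rfl⟩
  · rintro ⟨⟨j, i⟩, h, h'⟩
    cases h'
    exact congrArg _ h

theorem visits_onePointUnion_root [Fintype B] [∀ b, Finite (J b)] [∀ b j, NeZero (n b j)] :
    (onePointUnion C).visits (LocalAntimagic.onePointUnion H).root =
      ∑ b, (C b).visits (H b).root := by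
  classical
  have := fun b => Fintype.ofFinite (J b)
  simp only [← card_filter_walk_eq, Finset.card_filter, Fintype.sum_sigma]
  refine Finset.sum_congr rfl fun b _ => Finset.sum_congr rfl fun j _ =>
    Finset.sum_congr rfl fun i _ => ?_
  exact if_congr blockMap_eq_none_iff rfl rfl

end TrailCover

end Union

/-- A labeling of the edges of closed trails of lengths `n j` from a common root, such that two
consecutive labels add up to `x` and `y` alternately. The `i`-th edge of the trail `j` is labeled
`l j i`, where `i < n j`, so at odd positions `l j (i - 1) + l j i = x`. At the common root the sum
of the first and last labels over all trails is `y`. -/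
structure IsTwoSumLabeling {J : Type} [Fintype J] (n : J → ℕ) (l : J → ℕ → ℕ) (x y : ℕ) :
    Prop where
  ne : x ≠ y
  bijOn : Set.BijOn (fun t : J × ℕ => l t.1 t.2) {t | t.2 < n t.1} (Set.Icc 1 (∑ j, n j))
  add_of_even : ∀ j i, i + 1 < n j → Even i → l j i + l j (i + 1) = x
  add_of_odd : ∀ j i, i + 1 < n j → Odd i → l j i + l j (i + 1) = y
  sum_ends : ∑ j, (l j 0 + l j (n j - 1)) = y

theorem val_sub_one {m : ℕ} [NeZero m] {i : ZMod m} (hi : i ≠ 0) : (i - 1).val = i.val - 1 := by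
  have hpos : 1 ≤ i.val := ZMod.val_pos.mpr hi
  have hcast : i - 1 = ((i.val - 1 : ℕ) : ZMod m) := by
    rw [Nat.cast_sub hpos, ZMod.natCast_zmod_val, Nat.cast_one]
  rw [hcast, ZMod.val_cast_of_lt ((Nat.sub_le _ _).trans_lt (ZMod.val_lt i))]

theorem val_zero_sub_one (m : ℕ) [NeZero m] : (0 - 1 : ZMod m).val = m - 1 := by
  have hcast : (0 - 1 : ZMod m) = ((m - 1 : ℕ) : ZMod m) := by
    rw [Nat.cast_sub (NeZero.pos m), ZMod.natCast_self, Nat.cast_one]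
  rw [hcast, ZMod.val_cast_of_lt (Nat.sub_one_lt (NeZero.ne m))]

namespace IsTwoSumLabeling

variable {J : Type} [Fintype J] {n : J → ℕ} {l : J → ℕ → ℕ} {x y : ℕ}

theorem reindex {J' : Type} [Fintype J'] {n' : J' → ℕ} {l : J' → ℕ → ℕ}
    (h : IsTwoSumLabeling n' l x y) (e : J ≃ J') (he : ∀ j, n' (e j) = n j) :
    IsTwoSumLabeling n (fun j => l (e j)) x y where
  ne := h.ne
  bijOn := by
    have hsum : ∑ j, n j = ∑ j', n' j' := Fintype.sum_equiv e _ _ fun j => (he j).symm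
    rw [hsum]
    refine h.bijOn.comp (f := Prod.map e id) ⟨?_, ?_, ?_⟩
    · rintro ⟨j, i⟩ hi
      change i < n' (e j)
      rw [he]
      exact hi
    · exact (e.injective.prodMap Function.injective_id).injOn
    · rintro ⟨j', i⟩ hi
      obtain ⟨j, rfl⟩ := e.surjective j'
      refine ⟨(j, i), ?_, rfl⟩
      change i < n j
      rw [← he]
      exact hi
  add_of_even j i hi := h.add_of_even (e j) i (by rwa [he])
  add_of_odd j i hi := h.add_of_odd (e j) i (by rwa [he])
  sum_ends := by
    rw [← h.sum_ends]
    exact Fintype.sum_equiv e _ _ fun j => by simp only [he]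

variable (h : IsTwoSumLabeling n l x y) [∀ j, NeZero (n j)]
include h

theorem add_prev {j : J} {i : ZMod (n j)} (hi : i ≠ 0) :
    l j i.val + l j (i - 1).val = if Even i.val then y else x := by
  have hlt := ZMod.val_lt i
  have hpos : i.val ≠ 0 := (ZMod.val_ne_zero i).mpr hi
  obtain ⟨k, hk⟩ := Nat.exists_eq_succ_of_ne_zero hpos
  rw [val_sub_one hi, hk, Nat.succ_sub_one, add_comm]
  split_ifs with heven
  · exact h.add_of_odd j k (by lia) (by grind)
  · exact h.add_of_even j k (by lia) (by grind)

theorem bijOn_val : Set.BijOn (fun z : Σ j, ZMod (n j) => l z.1 z.2.val) Set.univ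
    (Set.Icc 1 (Nat.card (Σ j, ZMod (n j)))) := by
  have hcard : Nat.card (Σ j, ZMod (n j)) = ∑ j, n j := by simp
  rw [hcard]
  refine h.bijOn.comp (f := fun z : Σ j, ZMod (n j) => (z.1, z.2.val))
    ⟨fun z _ => ZMod.val_lt z.2, ?_, fun t ht => ?_⟩
  · rintro ⟨j, i⟩ - ⟨j', i'⟩ - hij
    obtain rfl : j = j' := congrArg Prod.fst hij
    exact congrArg (Sigma.mk j) (ZMod.val_injective _ (congrArg Prod.snd hij))
  · exact ⟨⟨t.1, t.2⟩, Set.mem_univ _, Prod.ext rfl (ZMod.val_cast_of_lt ht)⟩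

end IsTwoSumLabeling

section

variable {Γ : RootedGraph} {J : Type} [Fintype J] {n : J → ℕ} [∀ j, NeZero (n j)]
  (C : TrailCover Γ n)

open Finset

theorem TrailCover.sum_visits_root [DecidableEq Γ.V] {g : (Σ j, ZMod (n j)) → ℕ} {y : ℕ}
    (hg : ∀ j i, i ≠ 0 → C.walk j i = Γ.root → g ⟨j, i⟩ = y) :
    ∑ z with C.walk z.1 z.2 = Γ.root, g z + Fintype.card J * y =
      C.visits Γ.root * y + ∑ j, g ⟨j, 0⟩ := by
  classical
  let start : J ↪ Σ j, ZMod (n j) := ⟨fun j => ⟨j, 0⟩, fun _ _ h => congrArg Sigma.fst h⟩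
  have hstart : univ.map start ⊆ ({z | C.walk z.1 z.2 = Γ.root} : Finset (Σ j, ZMod (n j))) := by
    intro z hz
    obtain ⟨j, -, rfl⟩ := mem_map.mp hz
    simp only [mem_filter, mem_univ, true_and]
    exact C.walk_zero j
  have hrest : ∀ z ∈ ({z | C.walk z.1 z.2 = Γ.root} : Finset (Σ j, ZMod (n j))) \ univ.map start,
      g z = y := by
    rintro ⟨j, i⟩ hz
    obtain ⟨hz, hi⟩ := mem_sdiff.mp hz
    refine hg j i ?_ (by simpa using hz)
    rintro rfl
    exact hi (mem_map_of_mem start (mem_univ j))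
  rw [← C.card_filter_walk_eq, ← smul_eq_mul #_, ← sum_const, ← sum_sdiff hstart,
    ← sum_sdiff (f := fun _ => y) hstart, sum_congr rfl hrest, sum_map, sum_map]
  change _ + ∑ j, g ⟨j, 0⟩ + _ = _
  simp only [sum_const, card_univ, smul_eq_mul]
  ring

theorem TrailCover.chiLa_eq_two [Nonempty J] (hbip : Γ.graph.IsBipartite) {p : ℕ} (hp : p ≠ 0)
    (hvisits : ∀ v ≠ Γ.root, C.visits v = p) (hroot : C.visits Γ.root + 1 = p + Fintype.card J)
    {l : J → ℕ → ℕ} {x y : ℕ} (hl : IsTwoSumLabeling n l x y) : chiLa Γ.graph = 2 := by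
  classical
  have hpos := Fintype.card_pos (α := J)
  have : Finite Γ.V := C.finite fun v => by
    by_cases hv : v = Γ.root
    · rw [hv]; lia
    · rwa [hvisits v hv]
  let c : Γ.graph.Coloring Bool := hbip.toColoring (by simp)
  let g (z : Σ j, ZMod (n j)) : ℕ := l z.1 z.2.val + l z.1 (z.2 - 1).val
  have hg (j : J) (i : ZMod (n j)) (hi : i ≠ 0) :
      g ⟨j, i⟩ = if c (C.walk j i) = c Γ.root then y else x := by
    rw [if_congr (C.coloring_walk_eq_iff c j i) rfl rfl]
    exact hl.add_prev hi
  have hsum (v : Γ.V) :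
      ∑ z with C.walk z.1 z.2 = v, g z = p * if c v = c Γ.root then y else x := by
    by_cases hv : v = Γ.root
    · subst hv
      have h := C.sum_visits_root (g := g) (y := y) fun j i hi h => by rw [hg j i hi, h, if_pos rfl]
      have hends : ∑ j, g ⟨j, 0⟩ = y := by
        simp only [g, ZMod.val_zero, val_zero_sub_one, hl.sum_ends]
      rw [hends, ← Nat.succ_mul, Nat.succ_eq_add_one, hroot, add_mul] at h
      simpa using h
    · rw [← hvisits v hv, ← C.card_filter_walk_eq, ← smul_eq_mul, ← sum_const]
      refine sum_congr rfl fun z hz => ?_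
      obtain rfl : C.walk z.1 z.2 = v := by simpa using hz
      refine hg z.1 z.2 fun hi => hv ?_
      rw [hi, C.walk_zero]
  have hproper (u v : Γ.V) (huv : Γ.graph.Adj u v) :
      (p * if c u = c Γ.root then y else x) ≠ p * if c v = c Γ.root then y else x := by
    have hv : c v = c Γ.root ↔ ¬c u = c Γ.root := by
      rw [Bool.eq_not.mpr (c.valid huv).symm, Bool.not_eq]
    by_cases h : c u = c Γ.root <;> simp [h, hv, hp, hl.ne, hl.ne.symm]
  obtain ⟨f, hf, hlabel⟩ := C.toTraversal.exists_isLocalAntimagic hl.bijOn_val hproper fun v => by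
    rw [← hsum v]
    refine sum_congr rfl fun z _ => ?_
    rw [toTraversal_next_symm]
  obtain ⟨j⟩ := ‹Nonempty J›
  refine LocalAntimagic.chiLa_eq_two (C.adj_walk j 0) hf (x := p * x) (y := p * y) fun v => ?_
  simp only [hlabel]
  split_ifs <;> simp

end

theorem bijOn_of_surjOn_of_ncard_le {α β : Type} {f : α → β} {s : Set α} {t : Set β}
    (hs : s.Finite) (h : Set.SurjOn f s t) (hcard : s.ncard ≤ t.ncard) :
    Set.BijOn f s t := by
  have himage : t = f '' s :=
    Set.eq_of_subset_of_ncard_le h ((Set.ncard_image_le hs).trans hcard) (hs.image f)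
  refine ⟨fun a ha => himage ▸ ⟨a, ha, rfl⟩, Set.injOn_of_ncard_image_eq ?_ hs, h⟩
  exact le_antisymm (Set.ncard_image_le hs) (himage ▸ hcard)

/-- The labels `a`, `c + m * d`, `a + d`, `c + (m - 1) * d`, …, `a + m * d`, `c` of a closed trail
of length `2 * (m + 1)`: an increasing progression at the even positions and a decreasing one at
the odd positions. -/
def trailLabel (d a c m i : ℕ) : ℕ :=
  if Even i then a + i / 2 * d else c + (m - i / 2) * d

section Progressions

variable {d a c m x i : ℕ}

theorem trailLabel_two_mul (k : ℕ) : trailLabel d a c m (2 * k) = a + k * d := by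
  simp [trailLabel]

theorem trailLabel_two_mul_add_one (k : ℕ) :
    trailLabel d a c m (2 * k + 1) = c + (m - k) * d := by
  simp [trailLabel, Nat.mul_add_div]

theorem trailLabel_add_of_even (hx : a + c + m * d = x) (hi : i + 1 < 2 * (m + 1))
    (heven : Even i) : trailLabel d a c m i + trailLabel d a c m (i + 1) = x := by
  obtain ⟨k, rfl⟩ := even_iff_two_dvd.mp heven
  obtain ⟨e, rfl⟩ := Nat.exists_eq_add_of_le (show k ≤ m by lia)
  rw [trailLabel_two_mul, trailLabel_two_mul_add_one, Nat.add_sub_cancel_left, ← hx]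
  ring

theorem trailLabel_add_of_odd (hx : a + c + m * d = x) (hi : i + 1 < 2 * (m + 1))
    (hodd : Odd i) : trailLabel d a c m i + trailLabel d a c m (i + 1) = x + d := by
  obtain ⟨k, rfl⟩ := hodd
  obtain ⟨e, rfl⟩ := Nat.exists_eq_add_of_le (show k ≤ m by lia)
  rw [trailLabel_two_mul_add_one, show 2 * k + 1 + 1 = 2 * (k + 1) by ring, trailLabel_two_mul,
    Nat.add_sub_cancel_left, ← hx]
  ring

theorem trailLabel_zero : trailLabel d a c m 0 = a := by simp [trailLabel]

theorem trailLabel_last : trailLabel d a c m (2 * (m + 1) - 1) = c := by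
  rw [show 2 * (m + 1) - 1 = 2 * m + 1 by lia, trailLabel_two_mul_add_one, Nat.sub_self, zero_mul,
    add_zero]

theorem ncard_setOf_snd_lt {J : Type} [Fintype J] (n : J → ℕ) :
    {t : J × ℕ | t.2 < n t.1}.Finite ∧ {t : J × ℕ | t.2 < n t.1}.ncard = ∑ j, n j := by
  classical
  have h : {t : J × ℕ | t.2 < n t.1} = (Finset.univ.sigma fun j => Finset.range (n j)).map
      (Equiv.sigmaEquivProd J ℕ).toEmbedding := by
    ext ⟨j, i⟩
    simp
  rw [h, Set.ncard_coe_finset]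
  exact ⟨Finset.finite_toSet _, by simp⟩

theorem isTwoSumLabeling_of_progressions {J : Type} [Fintype J] {a c m : J → ℕ} (hd : d ≠ 0)
    (hx : ∀ j, a j + c j + m j * d = x) (hends : ∑ j, (a j + c j) = x + d)
    (hcover : ∀ y ∈ Set.Icc 1 (∑ j, 2 * (m j + 1)),
      ∃ j, ∃ i ≤ m j, y = a j + i * d ∨ y = c j + i * d) :
    IsTwoSumLabeling (fun j => 2 * (m j + 1)) (fun j => trailLabel d (a j) (c j) (m j))
      x (x + d) where
  ne := by lia
  bijOn := by
    obtain ⟨hfin, hcard⟩ := ncard_setOf_snd_lt fun j => 2 * (m j + 1)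
    refine bijOn_of_surjOn_of_ncard_le hfin (fun y hy => ?_) (by simp [hcard])
    obtain ⟨j, i, hi, rfl | rfl⟩ := hcover y hy
    · exact ⟨(j, 2 * i), by simp; lia, trailLabel_two_mul i⟩
    · refine ⟨(j, 2 * (m j - i) + 1), by simp; lia, ?_⟩
      exact (trailLabel_two_mul_add_one _).trans (by rw [Nat.sub_sub_self hi])
  add_of_even j _ := trailLabel_add_of_even (hx j)
  add_of_odd j _ := trailLabel_add_of_odd (hx j)
  sum_ends := by simpa only [trailLabel_zero, trailLabel_last] using hends

theorem exists_eq_add_mul {y : ℕ} (hd : d ≠ 0) (hy : 1 ≤ y) :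
    ∃ r q, 1 ≤ r ∧ r ≤ d ∧ y = r + q * d := by
  refine ⟨(y - 1) % d + 1, (y - 1) / d, by lia, Nat.mod_lt _ (Nat.pos_of_ne_zero hd), ?_⟩
  have := Nat.mod_add_div' (y - 1) d
  lia

end Progressions

/-- Closed trails whose lengths form the multiset `L` have a labeling in the sense of
`IsTwoSumLabeling`. -/
def IsTwoSumLabelable (L : Multiset ℕ) : Prop :=
  ∃ (J : Type) (_ : Fintype J) (n : J → ℕ) (l : J → ℕ → ℕ) (x y : ℕ),
    ∑ j, {n j} = L ∧ IsTwoSumLabeling n l x y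

theorem exists_equiv_of_sum_singleton_eq {J J' α : Type} [Fintype J] [Fintype J'] {n : J → α}
    {n' : J' → α} (h : ∑ j, ({n j} : Multiset α) = ∑ j, {n' j}) :
    ∃ e : J ≃ J', ∀ j, n' (e j) = n j := by
  classical
  have hfiber (k : α) : Nonempty ({j // n j = k} ≃ {j // n' j = k}) := by
    have hcount := congrArg (Multiset.count k) h
    simp only [Multiset.count_sum', Multiset.count_singleton, eq_comm (a := k),
      ← Finset.card_filter, ← Fintype.card_subtype] at hcount
    exact Fintype.card_eq.mp hcount
  let e (k : α) := (hfiber k).some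
  exact ⟨Equiv.ofFiberEquiv e, Equiv.ofFiberEquiv_map e⟩

theorem IsTwoSumLabelable.exists_isTwoSumLabeling {J : Type} [Fintype J] {n : J → ℕ}
    (h : IsTwoSumLabelable (∑ j, {n j})) : ∃ l x y, IsTwoSumLabeling n l x y := by
  obtain ⟨J', _, n', l, x, y, hn, hl⟩ := h
  obtain ⟨e, he⟩ := exists_equiv_of_sum_singleton_eq hn.symm
  exact ⟨_, x, y, hl.reindex e he⟩

theorem exists_long_trails_label {v y : ℕ} (hy : 1 ≤ y) (hlt : y < (2 * v + 3) * (2 * v + 3)) :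
    (∃ q ≤ v, y = 2 * v + 3 + q * (2 * v + 3) ∨ y = (v + 2) * (2 * v + 3) + q * (2 * v + 3)) ∨
      ∃ i < v + 1, ∃ q ≤ 2 * v + 2,
        y = i + 1 + q * (2 * v + 3) ∨ y = 2 * v + 2 - i + q * (2 * v + 3) := by
  obtain ⟨r, q, hr, hrd, rfl⟩ := exists_eq_add_mul (d := 2 * v + 3) (by lia) hy
  have hq : q < 2 * v + 3 := by nlinarith
  rcases hrd.eq_or_lt with rfl | hrd
  · have hq' : q + 1 < 2 * v + 3 := by nlinarith
    left
    rcases le_or_gt q v with hqv | hqv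
    · exact ⟨q, hqv, .inl rfl⟩
    · obtain ⟨e, rfl⟩ := Nat.exists_eq_add_of_lt hqv
      exact ⟨e, by lia, .inr (by ring)⟩
  · right
    rcases le_or_gt r (v + 1) with hrv | hrv
    · exact ⟨r - 1, by lia, q, by lia, .inl (by lia)⟩
    · exact ⟨2 * v + 2 - r, by lia, q, by lia, .inr (by lia)⟩

theorem isTwoSumLabelable_of_long_trails (v : ℕ) :
    IsTwoSumLabelable ((v + 1) • {4 * v + 6} + {2 * v + 2}) := by
  have hpair (i : Fin (v + 1)) : i + 1 + (2 * v + 2 - i) = 2 * v + 3 := by lia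
  refine ⟨Option (Fin (v + 1)), inferInstance, _, _, (2 * v + 3) ^ 2, _, ?_,
    isTwoSumLabeling_of_progressions (d := 2 * v + 3)
      (a := fun j => j.elim (2 * v + 3) fun i => i + 1)
      (c := fun j => j.elim ((v + 2) * (2 * v + 3)) fun i => 2 * v + 2 - i)
      (m := fun j => j.elim v fun _ => 2 * v + 2) (by lia) ?_ ?_ ?_⟩
  · simp only [Fintype.sum_option, Option.elim_none, Option.elim_some, Finset.sum_const,
      Finset.card_univ, Fintype.card_fin, show 2 * (2 * v + 2 + 1) = 4 * v + 6 by ring,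
      show 2 * (v + 1) = 2 * v + 2 by ring]
    exact add_comm _ _
  · rintro (_ | i)
    · simp only [Option.elim_none]
      ring
    · simp only [Option.elim_some, hpair]
      ring
  · simp only [Fintype.sum_option, Option.elim_none, Option.elim_some, hpair, Finset.sum_const,
      Finset.card_univ, Fintype.card_fin, smul_eq_mul]
    ring
  · rintro y ⟨hy, hle⟩
    have hlt : y < (2 * v + 3) * (2 * v + 3) := by
      simp only [Fintype.sum_option, Option.elim_none, Option.elim_some, Finset.sum_const,
        Finset.card_univ, Fintype.card_fin, smul_eq_mul] at hle
      nlinarith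
    rcases exists_long_trails_label hy hlt with ⟨q, hq, h⟩ | ⟨i, hi, q, hq, h⟩
    · exact ⟨none, q, hq, h⟩
    · exact ⟨some ⟨i, hi⟩, q, hq, h⟩

theorem exists_short_trails_label {w y : ℕ} (hy : 1 ≤ y)
    (hlt : y < (2 * w + 1) * (4 * w + 1)) :
    (∃ i < w, ∃ q ≤ 2 * w, y = i + 1 + q * (4 * w + 2) ∨ y = 2 * w - i + q * (4 * w + 2)) ∨
      ∃ i < w + 1, ∃ q ≤ 2 * w - 1,
        y = 2 * w + 1 + i + q * (4 * w + 2) ∨ y = 4 * w + 2 - i + q * (4 * w + 2) := by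
  obtain ⟨r, q, hr, hrd, rfl⟩ := exists_eq_add_mul (d := 4 * w + 2) (by lia) hy
  have hq : q ≤ 2 * w := by nlinarith
  by_cases hrw : r ≤ 2 * w
  · left
    rcases le_or_gt r w with hrw' | hrw'
    · exact ⟨r - 1, by lia, q, hq, .inl (by lia)⟩
    · exact ⟨2 * w - r, by lia, q, hq, .inr (by lia)⟩
  · have hq' : q < 2 * w := by nlinarith
    right
    rcases le_or_gt r (3 * w + 1) with hrw' | hrw'
    · exact ⟨r - (2 * w + 1), by lia, q, by lia, .inl (by lia)⟩
    · exact ⟨4 * w + 2 - r, by lia, q, by lia, .inr (by lia)⟩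

theorem isTwoSumLabelable_of_short_trails {w : ℕ} (hw : w ≠ 0) :
    IsTwoSumLabelable (w • {4 * w + 2} + (w + 1) • {4 * w}) := by
  have hodd (i : Fin w) : i + 1 + (2 * w - i) = 2 * w + 1 := by lia
  have heven (i : Fin (w + 1)) : 2 * w + 1 + i + (4 * w + 2 - i) = 6 * w + 3 := by lia
  have hm : 2 * (2 * w - 1 + 1) = 4 * w := by lia
  have hm' : 2 * (2 * w + 1) = 4 * w + 2 := by ring
  refine ⟨Fin w ⊕ Fin (w + 1), inferInstance, _, _, (2 * w + 1) * (4 * w + 1), _, ?_,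
    isTwoSumLabeling_of_progressions (d := 4 * w + 2)
      (a := Sum.elim (fun i : Fin w => (i + 1 : ℕ)) fun i : Fin (w + 1) => 2 * w + 1 + i)
      (c := Sum.elim (fun i : Fin w => 2 * w - i) fun i : Fin (w + 1) => 4 * w + 2 - i)
      (m := Sum.elim (fun _ => 2 * w) fun _ => 2 * w - 1) (by lia) ?_ ?_ ?_⟩
  · simp only [Fintype.sum_sum_type, Sum.elim_inl, Sum.elim_inr, hm, hm', Finset.sum_const,
      Finset.card_univ, Fintype.card_fin]
  · rintro (i | i)
    · simp only [Sum.elim_inl, hodd]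
      ring
    · obtain ⟨u, rfl⟩ := Nat.exists_eq_add_one_of_ne_zero hw
      simp only [Sum.elim_inr, heven, show 2 * (u + 1) - 1 = 2 * u + 1 by lia]
      ring
  · simp only [Fintype.sum_sum_type, Sum.elim_inl, Sum.elim_inr, hodd, heven, Finset.sum_const,
      Finset.card_univ, Fintype.card_fin, smul_eq_mul]
    ring
  · rintro y ⟨hy, hle⟩
    have hlt : y < (2 * w + 1) * (4 * w + 1) := by
      simp only [Fintype.sum_sum_type, Sum.elim_inl, Sum.elim_inr, hm, Finset.sum_const,
        Finset.card_univ, Fintype.card_fin, smul_eq_mul] at hle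
      nlinarith
    rcases exists_short_trails_label hy hlt with ⟨i, hi, q, hq, h⟩ | ⟨i, hi, q, hq, h⟩
    · exact ⟨.inl ⟨i, hi⟩, q, hq, h⟩
    · exact ⟨.inr ⟨i, hi⟩, q, hq, h⟩

section Circulant

variable {m : ℕ} {S : Finset ℕ}

theorem circulant_adj {u v : ZMod m} : (circulant m S).graph.Adj u v ↔
    u ≠ v ∧ ((∃ a ∈ S, (a : ZMod m) = u - v) ∨ ∃ a ∈ S, (a : ZMod m) = v - u) := by
  simp [circulant, SimpleGraph.circulantGraph_adj]

theorem natCast_ne_zero_of_lt {a : ℕ} (h0 : 0 < a) (h : a < m) : (a : ZMod m) ≠ 0 := by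
  rw [Ne, ZMod.natCast_eq_zero_iff]
  exact Nat.not_dvd_of_pos_of_lt h0 h

theorem injective_circulant_edge (hS : ∀ a ∈ S, 0 < a ∧ 2 * a < m) :
    Function.Injective fun x : S × ZMod m => s(x.2, x.2 + (x.1 : ℕ)) := by
  rintro ⟨⟨a, ha⟩, i⟩ ⟨⟨b, hb⟩, j⟩ h
  have ha' := hS a ha
  have hb' := hS b hb
  rcases Sym2.eq_iff.mp h with ⟨rfl, hab⟩ | ⟨rfl, hab⟩
  · rw [add_right_inj, ZMod.natCast_eq_natCast_iff] at hab
    obtain rfl := hab.eq_of_lt_of_lt (by lia) (by lia)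
    rfl
  · rw [add_assoc, add_eq_left, ← Nat.cast_add] at hab
    exact absurd hab (natCast_ne_zero_of_lt (by lia) (by lia))

/-- The traversal of a circulant graph along the cycles that are generated by its jumps. -/
def circulantTraversal (hS : ∀ a ∈ S, 0 < a ∧ 2 * a < m) :
    EdgeTraversal (circulant m S).graph (S × ZMod m) where
  next := Equiv.prodShear (Equiv.refl S) fun a => Equiv.addRight ((a : ℕ) : ZMod m)
  vertex x := x.2
  bijOn_edge := by
    refine ⟨?_, (injective_circulant_edge hS).injOn, ?_⟩
    · rintro ⟨⟨a, ha⟩, i⟩ -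
      have hne := natCast_ne_zero_of_lt (hS a ha).1 (show a < m by grind)
      exact circulant_adj.mpr ⟨by simpa using hne, .inr ⟨a, ha, by simp⟩⟩
    · intro e he
      induction e with | _ u v
      change ZMod m at u v
      obtain ⟨-, ⟨a, ha, h⟩ | ⟨a, ha, h⟩⟩ := circulant_adj.mp he
      · refine ⟨(⟨a, ha⟩, v), Set.mem_univ _, ?_⟩
        change s(v, v + (a : ZMod m)) = s(u, v)
        rw [h, add_sub_cancel, Sym2.eq_swap]
      · refine ⟨(⟨a, ha⟩, u), Set.mem_univ _, ?_⟩
        change s(u, u + (a : ZMod m)) = s(u, v)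
        rw [h, add_sub_cancel]

theorem ncard_edgeSet_circulant (hS : ∀ a ∈ S, 0 < a ∧ 2 * a < m) :
    (circulant m S).graph.edgeSet.ncard = S.card * m := by
  rw [(circulantTraversal hS).ncard_edgeSet, Nat.card_prod, Nat.card_zmod]
  simp

theorem TrailCover.visits_circulant [NeZero m] (hS : ∀ a ∈ S, 0 < a ∧ 2 * a < m) {J : Type}
    [Finite J] {n : J → ℕ} [∀ j, NeZero (n j)] (C : TrailCover (circulant m S) n) (v : ZMod m) :
    C.visits v = S.card := by
  have hpos : {x : S × ZMod m | x.2 = v} = Set.univ ×ˢ {v} := by ext; simp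
  have hvisits : (circulantTraversal hS).visits v = S.card := by
    change {x : S × ZMod m | x.2 = v}.ncard = _
    rw [hpos, Set.ncard_prod]
    simp
  exact (C.toTraversal.visits_eq_visits (circulantTraversal hS) v).trans hvisits

theorem bijective_prod_mul (hS : ∀ a ∈ S, a.Coprime m) :
    Function.Bijective fun x : Σ _ : S, ZMod m => (x.1, (x.1 : ZMod m) * x.2) := by
  have hunit (a : S) : IsUnit (a : ZMod m) := (ZMod.isUnit_iff_coprime _ _).mpr (hS a a.2)
  refine ⟨?_, fun ⟨a, i⟩ => ?_⟩
  · rintro ⟨a, i⟩ ⟨b, j⟩ h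
    obtain rfl : a = b := congrArg Prod.fst h
    exact congrArg (Sigma.mk a) ((hunit a).mul_left_cancel (congrArg Prod.snd h))
  · obtain ⟨j, hj⟩ := (hunit a).dvd (a := i)
    exact ⟨⟨a, j⟩, by simp [hj]⟩

/-- A circulant graph whose jumps are coprime to the order decomposes into the Hamiltonian cycles
that are generated by the jumps. -/
def circulantCover (hS : ∀ a ∈ S, 0 < a ∧ 2 * a < m) (hcoprime : ∀ a ∈ S, a.Coprime m) :
    TrailCover (circulant m S) fun _ : S => m where
  walk a i := (a : ZMod m) * i
  walk_zero a := mul_zero (a : ZMod m)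
  bijOn_edge := by
    refine ((circulantTraversal hS).bijOn_edge.comp
      (bijective_prod_mul hcoprime).bijOn_univ).congr fun x _ => ?_
    change s((x.1 : ZMod m) * x.2, (x.1 : ZMod m) * x.2 + (x.1 : ZMod m)) =
      s((x.1 : ZMod m) * x.2, (x.1 : ZMod m) * (x.2 + 1))
    rw [mul_add_one]

/-- The parity of the vertices as a colouring of a circulant graph of even order with odd jumps. -/
def parityColoring (hm : 2 ∣ m) (hS : ∀ a ∈ S, Odd a) :
    (circulant m S).graph.Coloring (ZMod 2) :=
  SimpleGraph.Coloring.mk (ZMod.castHom hm (ZMod 2)) @fun (u v : ZMod m) huv heq => by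
    have hodd (a : ℕ) (ha : a ∈ S) : ZMod.castHom hm (ZMod 2) a ≠ 0 := by
      rw [map_natCast, ZMod.natCast_eq_one_iff_odd.mpr (hS a ha)]
      exact one_ne_zero
    obtain ⟨-, ⟨a, ha, h⟩ | ⟨a, ha, h⟩⟩ := circulant_adj.mp huv <;>
      exact hodd a ha (by rw [h, map_sub, heq, sub_self])

theorem isBipartite_circulant (hm : 2 ∣ m) (hS : ∀ a ∈ S, Odd a) :
    (circulant m S).graph.IsBipartite :=
  ⟨parityColoring hm hS⟩

theorem isCirculant_circulant [NeZero m] : IsCirculant (circulant m S).graph :=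
  ⟨m, NeZero.one_le, _, ⟨SimpleGraph.Iso.refl⟩⟩

end Circulant

/-- `Γ` is bipartite and decomposes into closed trails from its root whose lengths form the
multiset `L`, such that every vertex is visited `p` times. -/
def HasTrailCover (Γ : RootedGraph) (p : ℕ) (L : Multiset ℕ) : Prop :=
  Γ.graph.IsBipartite ∧ ∃ (J : Type) (_ : Fintype J) (n : J → ℕ) (C : TrailCover Γ n),
    (∀ j, NeZero (n j)) ∧ ∑ j, {n j} = L ∧ ∀ v, C.visits v = p

theorem IsJumpSet.pos {m p : ℕ} {S : Finset ℕ} (hm : 2 ∣ m) (hS : IsJumpSet m p S) :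
    ∀ a ∈ S, 0 < a ∧ 2 * a < m := by
  intro a ha
  obtain ⟨hlt, hcoprime⟩ := hS.2.2 a ha
  refine ⟨Nat.pos_of_ne_zero ?_, hlt⟩
  rintro rfl
  rw [Nat.coprime_zero_left] at hcoprime
  lia

theorem IsJumpSet.hasTrailCover {m p : ℕ} {S : Finset ℕ} [NeZero m] (hm : 2 ∣ m)
    (hS : IsJumpSet m p S) : HasTrailCover (circulant m S) p (p • {m}) := by
  have hcoprime (a : ℕ) (ha : a ∈ S) : a.Coprime m := (hS.2.2 a ha).2
  have hodd (a : ℕ) (ha : a ∈ S) : Odd a :=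
    Nat.coprime_two_right.mp ((hcoprime a ha).coprime_dvd_right hm)
  refine ⟨isBipartite_circulant hm hodd, S, inferInstance, _,
    circulantCover (hS.pos hm) hcoprime, fun _ => inferInstance, ?_, fun v => ?_⟩
  · simp [hS.1]
  · exact (TrailCover.visits_circulant (hS.pos hm) _ v).trans hS.1

/-- The closed trail along the cycle `C_n`. -/
def cycleCover {n : ℕ} (hn : 2 < n) :
    TrailCover (circulant n {1}) fun _ : ({1} : Finset ℕ) => n :=
  circulantCover (by simpa using hn) (by simp)

section MergedCycle

variable {n : ℕ} {P : Setoid (ZMod n)}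

theorem bijOn_mergedCycle_edgeSet (hP : MergesSimply n P) :
    Set.BijOn (Sym2.map (Quotient.mk P)) (circulant n {1}).graph.edgeSet
      (mergedCycle n P).graph.edgeSet := by
  refine ⟨fun e he => ?_, hP.2, fun e he => ?_⟩
  · induction e with | _ u v
    exact (SimpleGraph.map_adj' _ _ _ _).mpr
      ⟨fun h => hP.1 u v he (Quotient.exact h), u, v, he, rfl, rfl⟩
  · induction e with | _ u v
    obtain ⟨-, u, v, huv, rfl, rfl⟩ := (SimpleGraph.map_adj' _ _ _ _).mp he
    exact ⟨s(u, v), huv, rfl⟩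

theorem IsParityPairing.castHom_eq [NeZero n] (hP : IsParityPairing n P) (hn : 2 ∣ n) {x y : ZMod n}
    (hxy : P x y) : ZMod.castHom hn (ZMod 2) x = ZMod.castHom hn (ZMod 2) y := by
  rw [← ZMod.natCast_zmod_val x, ← ZMod.natCast_zmod_val y, map_natCast, map_natCast,
    ZMod.natCast_eq_natCast_iff]
  exact hP.2 x y hxy

theorem isBipartite_mergedCycle [NeZero n] (hn : 2 ∣ n) (hP : IsParityPairing n P) :
    (mergedCycle n P).graph.IsBipartite := by
  let c := parityColoring (m := n) (S := {1}) hn (by simp)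
  refine ⟨SimpleGraph.Coloring.mk (α := ZMod 2)
    (Quotient.lift c fun x y hxy => hP.castHom_eq hn hxy) fun huv => ?_⟩
  obtain ⟨-, u, v, hadj, rfl, rfl⟩ := (SimpleGraph.map_adj' _ _ _ _).mp huv
  exact c.valid hadj

theorem hasTrailCover_mergedCycle (hn : 2 ∣ n) (hn2 : 2 < n) (hP : IsParityPairing n P)
    (hsimple : MergesSimply n P) : HasTrailCover (mergedCycle n P) 2 {n} := by
  have : NeZero n := ⟨by lia⟩
  refine ⟨isBipartite_mergedCycle hn hP, _, inferInstance, _,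
    (cycleCover hn2).map (Γ' := mergedCycle n P) (Quotient.mk P) rfl
      (bijOn_mergedCycle_edgeSet hsimple), fun _ => inferInstance, by simp, fun v => ?_⟩
  have : Finite (circulant n {1}).V := inferInstanceAs (Finite (ZMod n))
  have hclass (x : ZMod n) : {y | Quotient.mk P y = Quotient.mk P x}.ncard = 2 := by
    rw [← hP.1 x]
    congr 1 with y
    exact Quotient.eq.trans ⟨P.symm, P.symm⟩
  refine (TrailCover.visits_map _
    (fun u => TrailCover.visits_circulant (by simpa using hn2) (cycleCover hn2) u) v).trans ?_
  obtain ⟨x, rfl⟩ := Quotient.exists_rep v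
  exact (mul_one _).trans (hclass x)

end MergedCycle

section EulerCircuit

/-- The vertices of an Euler circuit of the graph on `ZMod (M * p)` in which two integers are
adjacent if they differ by `1` or `-1` modulo `M`. If `M` is even, the position
`M * (p * a + b) + r` with `r < M` and `b < p` is at the vertex `r + M * a` for even `r` and at
`r + M * b` for odd `r`, so that all pairs `(a, b)` occur between the residues `r` and `r + 1`. -/
def eulerVertex (M p I : ℕ) : ZMod (M * p) :=
  (I % M + M * if Even I then I / M / p else I / M % p : ℕ)

variable {M p : ℕ}

theorem eulerVertex_mul_add (hM : Even M) {a b r : ℕ} (hb : b < p) (hr : r < M) :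
    eulerVertex M p (M * (p * a + b) + r) = (r + M * if Even r then a else b : ℕ) := by
  have hdiv : (M * (p * a + b) + r) / M = p * a + b := by
    rw [Nat.mul_add_div (by lia), Nat.div_eq_of_lt hr, add_zero]
  have hdiv' : (p * a + b) / p = a := by
    rw [Nat.mul_add_div (by lia), Nat.div_eq_of_lt hb, add_zero]
  have heven : Even (M * (p * a + b) + r) ↔ Even r := by simp [Nat.even_add, hM.mul_right]
  simp only [eulerVertex, heven, hdiv, hdiv', Nat.mul_add_mod, Nat.mod_eq_of_lt hr,
    Nat.mod_eq_of_lt hb]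

theorem eulerVertex_periodic [NeZero M] [NeZero p] (hM : Even M) :
    (eulerVertex M p).Periodic (M * (p * p)) := by
  intro I
  have hr := Nat.mod_lt I (NeZero.pos M)
  have hb := Nat.mod_lt (I / M) (NeZero.pos p)
  have hI : I = M * (p * (I / M / p) + I / M % p) + I % M := by
    rw [Nat.div_add_mod, Nat.div_add_mod]
  generalize I / M / p = a, I / M % p = b, I % M = r at *
  rw [hI, show M * (p * a + b) + r + M * (p * p) = M * (p * (a + p) + b) + r by ring,
    eulerVertex_mul_add hM hb hr, eulerVertex_mul_add hM hb hr]
  split_ifs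
  · rw [mul_add, ← add_assoc, Nat.cast_add _ (M * p), ZMod.natCast_self, add_zero]
  · rfl

theorem exists_eulerVertex_eq_of_succ_lt (hM : Even M) {r x y : ℕ} (hr : r + 1 < M) (hx : x < p)
    (hy : y < p) : ∃ I, eulerVertex M p I = (r + M * x : ℕ) ∧
      eulerVertex M p (I + 1) = (r + 1 + M * y : ℕ) := by
  by_cases heven : Even r
  · refine ⟨M * (p * x + y) + r, ?_, ?_⟩
    · rw [eulerVertex_mul_add hM hy (Nat.lt_of_succ_lt hr), if_pos heven]
    · rw [add_assoc, eulerVertex_mul_add hM hy hr, if_neg (by rwa [Nat.even_add_one, not_not])]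
  · refine ⟨M * (p * y + x) + r, ?_, ?_⟩
    · rw [eulerVertex_mul_add hM hx (Nat.lt_of_succ_lt hr), if_neg heven]
    · rw [add_assoc, eulerVertex_mul_add hM hx hr, if_pos (by rwa [Nat.even_add_one])]

theorem exists_eulerVertex_eq_of_succ_eq (hM : Even M) {r x : ℕ} (y : ℕ) (hr : r + 1 = M)
    (hx : x < p) : ∃ I, eulerVertex M p I = (r + M * x : ℕ) ∧
      eulerVertex M p (I + 1) = (M * y : ℕ) := by
  have hodd : ¬ Even r := by rwa [← Nat.even_add_one, hr]
  have hvertex (a : ℕ) : eulerVertex M p (M * (p * a + x) + r) = (r + M * x : ℕ) := by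
    rw [eulerVertex_mul_add hM hx (by lia), if_neg hodd]
  have hnext {a b : ℕ} (hb : b < p) : eulerVertex M p (M * (p * a + b)) = (M * a : ℕ) := by
    have h := eulerVertex_mul_add hM (a := a) hb (show 0 < M by lia)
    rwa [if_pos Even.zero, add_zero, zero_add] at h
  rcases lt_or_eq_of_le (show x + 1 ≤ p from hx) with hx1 | hx1
  · refine ⟨M * (p * y + x) + r, hvertex y, ?_⟩
    rw [show M * (p * y + x) + r + 1 = M * (p * y + (x + 1)) by lia, hnext hx1]
  · refine ⟨M * (p * (y + x) + x) + r, hvertex _, ?_⟩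
    rw [show M * (p * (y + x) + x) + r + 1 = M * (p * (y + p) + 0) by rw [← hx1, ← hr]; ring,
      hnext (by lia), mul_add, Nat.cast_add, ZMod.natCast_self, add_zero]

theorem exists_eulerVertex_eq (hM : Even M) {u v : ℕ} (hu : u < M * p) (hv : v < M * p)
    (h : (u + 1) % M = v % M) :
    ∃ I, eulerVertex M p I = u ∧ eulerVertex M p (I + 1) = v := by
  have hr := Nat.mod_lt u (Nat.pos_of_mul_pos_right (Nat.zero_lt_of_lt hu))
  have hx := Nat.div_lt_of_lt_mul hu
  have hy := Nat.div_lt_of_lt_mul hv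
  rw [← Nat.mod_add_div u M, ← Nat.mod_add_div v M, ← h, ← Nat.mod_add_mod u M 1]
  rcases lt_or_eq_of_le (show u % M + 1 ≤ M from hr) with hr1 | hr1
  · rw [Nat.mod_eq_of_lt hr1]
    exact exists_eulerVertex_eq_of_succ_lt hM hr1 hx hy
  · rw [hr1, Nat.mod_self, zero_add]
    exact exists_eulerVertex_eq_of_succ_eq hM _ hr1 hx

variable {S : Finset ℕ}

theorem exists_eulerVertex_edge_eq [NeZero M] [NeZero p] (hM : Even M)
    (hS : ∀ a ∈ S, (a : ZMod M) = 1 ∨ (a : ZMod M) = -1) {u v : ZMod (M * p)}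
    (huv : (circulant (M * p) S).graph.Adj u v) :
    ∃ I, s(eulerVertex M p I, eulerVertex M p (I + 1)) = s(u, v) := by
  let residue := ZMod.castHom (Dvd.intro p rfl : M ∣ M * p) (ZMod M)
  have of_residue_sub {x y : ZMod (M * p)} (h : residue (y - x) = 1) :
      ∃ I, eulerVertex M p I = x ∧ eulerVertex M p (I + 1) = y := by
    have hval (z : ZMod (M * p)) : residue z = (z.val : ZMod M) := (ZMod.natCast_val z).symm
    rw [map_sub, sub_eq_iff_eq_add', hval, hval, ← Nat.cast_add_one, eq_comm,
      ZMod.natCast_eq_natCast_iff'] at h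
    simpa using exists_eulerVertex_eq hM x.val_lt y.val_lt h
  have hresidue : residue (v - u) = 1 ∨ residue (u - v) = 1 := by
    have hneg (a : ℕ) (ha : a ∈ S) : residue a = 1 ∨ residue (-a) = 1 := by
      rw [map_neg, map_natCast, neg_eq_iff_eq_neg]
      exact hS a ha
    obtain ⟨-, ⟨a, ha, h⟩ | ⟨a, ha, h⟩⟩ := circulant_adj.mp huv
    · simpa only [h, neg_sub, or_comm] using hneg a ha
    · simpa only [h, neg_sub] using hneg a ha
  rcases hresidue with h | h
  · obtain ⟨I, rfl, rfl⟩ := of_residue_sub h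
    exact ⟨I, rfl⟩
  · obtain ⟨I, rfl, rfl⟩ := of_residue_sub h
    exact ⟨I, Sym2.eq_swap⟩

theorem eulerVertex_val_natCast [NeZero M] [NeZero p] (hM : Even M) (I : ℕ) :
    eulerVertex M p (I : ZMod (M * (p * p))).val = eulerVertex M p I := by
  rw [ZMod.val_natCast, (eulerVertex_periodic hM).map_mod_nat]

/-- The decomposition of a circulant graph on `ZMod (M * p)` with `p` jumps that are `1` or `-1`
modulo `M` into a single closed trail. -/
def eulerCover [NeZero M] [NeZero p] (hM : Even M) (hpos : ∀ a ∈ S, 0 < a ∧ 2 * a < M * p)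
    (hS : ∀ a ∈ S, (a : ZMod M) = 1 ∨ (a : ZMod M) = -1) (hcard : S.card = p) :
    TrailCover (circulant (M * p) S) fun _ : Unit => M * (p * p) where
  walk _ i := eulerVertex M p i.val
  walk_zero _ := by
    rw [ZMod.val_zero]
    simp [eulerVertex, circulant]
  bijOn_edge := by
    refine bijOn_of_surjOn_of_ncard_le Set.finite_univ (fun e he => ?_) ?_
    · induction e with | _ u v
      obtain ⟨I, h⟩ := exists_eulerVertex_edge_eq hM hS he
      refine ⟨⟨(), I⟩, Set.mem_univ _, ?_⟩
      refine Eq.trans ?_ h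
      rw [← eulerVertex_val_natCast hM I, ← eulerVertex_val_natCast hM (I + 1), Nat.cast_add_one]
      rfl
    · rw [ncard_edgeSet_circulant hpos, hcard, Set.ncard_univ, Nat.card_sigma]
      simp [mul_left_comm]

theorem hasTrailCover_circulant_of_forall_eq_one_or_neg_one [NeZero M] [NeZero p] (hM : Even M)
    (hpos : ∀ a ∈ S, 0 < a ∧ 2 * a < M * p)
    (hS : ∀ a ∈ S, (a : ZMod M) = 1 ∨ (a : ZMod M) = -1) (hcard : S.card = p) :
    HasTrailCover (circulant (M * p) S) p {M * (p * p)} := by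
  have hodd (a : ℕ) (ha : a ∈ S) : Odd a := by
    rw [← ZMod.natCast_eq_one_iff_odd, ← map_natCast (ZMod.castHom hM.two_dvd (ZMod 2)) a]
    rcases hS a ha with h | h <;> rw [h] <;> simp only [map_neg, map_one, ZMod.neg_eq_self_mod_two]
  refine ⟨isBipartite_circulant (hM.two_dvd.mul_right p) hodd, Unit, inferInstance, _,
    eulerCover hM hpos hS hcard, fun _ => inferInstance, by simp, fun v => ?_⟩
  exact (TrailCover.visits_circulant hpos _ v).trans hcard

end EulerCircuit

section Jumps

variable {s t : ℕ}

theorem forall_mem_jumps {q : ℕ → Prop} : (∀ a ∈ jumps s t, q a) ↔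
    ∀ l < 2 ^ (s - 2), q (1 + l * (2 * t + 4)) ∧ q (2 * t + 3 + l * (2 * t + 4)) := by
  simp [jumps, or_imp, forall_and]

theorem card_jumps (hs : 2 ≤ s) : (jumps s t).card = 2 ^ (s - 1) := by
  have hinj (c : ℕ) : Function.Injective fun l => c + l * (2 * t + 4) := fun l l' h => by
    simpa using h
  have hdisj : Disjoint ((Finset.range (2 ^ (s - 2))).image fun l => 1 + l * (2 * t + 4))
      ((Finset.range (2 ^ (s - 2))).image fun l => 2 * t + 3 + l * (2 * t + 4)) := by
    simp only [Finset.disjoint_left, Finset.mem_image]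
    rintro _ ⟨l, -, rfl⟩ ⟨l', -, heq⟩
    have h := congrArg (· % (2 * t + 4)) heq
    simp only [Nat.add_mul_mod_self_right] at h
    rw [Nat.mod_eq_of_lt (by lia), Nat.mod_eq_of_lt (by lia)] at h
    lia
  rw [jumps, Finset.card_union_of_disjoint hdisj, Finset.card_image_of_injective _ (hinj _),
    Finset.card_image_of_injective _ (hinj _), Finset.card_range, ← two_mul, ← pow_succ']
  congr 1
  lia

theorem pos_and_lt_of_mem_jumps (hs : 2 ≤ s) :
    ∀ a ∈ jumps s t, 0 < a ∧ 2 * a < (2 * t + 4) * 2 ^ (s - 1) := by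
  have hpow : 2 ^ (s - 1) = 2 * 2 ^ (s - 2) := by
    rw [← pow_succ']
    congr 1
    lia
  refine forall_mem_jumps.mpr fun l hl => ?_
  have hle := Nat.mul_le_mul_right (2 * t + 4) (Nat.succ_le_of_lt hl)
  rw [hpow]
  constructor <;> constructor <;> nlinarith

theorem hasTrailCover_circulant_jumps (hs : 2 ≤ s) :
    HasTrailCover (circulant (2 ^ s * (t + 2)) (jumps s t)) (2 ^ (s - 1))
      {2 * (2 ^ (2 * s - 2) * (t + 2))} := by
  have horder : 2 ^ s * (t + 2) = (2 * t + 4) * 2 ^ (s - 1) := by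
    obtain ⟨e, rfl⟩ := Nat.exists_eq_add_of_le' hs
    rw [show e + 2 - 1 = e + 1 by lia]
    ring
  have hlength : 2 * (2 ^ (2 * s - 2) * (t + 2)) = (2 * t + 4) * (2 ^ (s - 1) * 2 ^ (s - 1)) := by
    rw [← pow_add, show s - 1 + (s - 1) = 2 * s - 2 by lia]
    ring
  rw [horder, hlength]
  refine hasTrailCover_circulant_of_forall_eq_one_or_neg_one ⟨t + 2, by ring⟩
    (pos_and_lt_of_mem_jumps hs) (forall_mem_jumps.mpr fun l _ => ⟨.inl ?_, .inr ?_⟩)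
    (card_jumps hs)
  · rw [Nat.cast_add, Nat.cast_mul, ZMod.natCast_self]
    simp
  · rw [eq_neg_iff_add_eq_zero, ← Nat.cast_add_one, ZMod.natCast_eq_zero_iff]
    exact ⟨l + 1, by ring⟩

end Jumps

section SimpleMerging

/-- The shift that takes a vertex of the cycle of length `4 * h` to its partner in a pairing that
merges simply. -/
def pairingShift (h v : ℕ) : ℕ :=
  if Even v then 2 * h else if v + 4 < 2 * h then 2 * h + 4 else if v < 2 * h then 4 else
    if v < 2 * h + 4 then 4 * h - 4 else 2 * h - 4

variable {h : ℕ}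

theorem even_pairingShift (hh : 2 ≤ h) (v : ℕ) : Even (pairingShift h v) := by
  unfold pairingShift
  split_ifs <;> grind

theorem pairingShift_pos_and_lt (hh : 4 ≤ h) (v : ℕ) :
    0 < pairingShift h v ∧ pairingShift h v < 4 * h := by
  unfold pairingShift
  grind

theorem pairingShift_partner (hh : 4 ≤ h) {v : ℕ} (hv : v < 4 * h) :
    pairingShift h ((v + pairingShift h v) % (4 * h)) + pairingShift h v = 4 * h := by
  rcases lt_or_ge (v + pairingShift h v) (4 * h) with hlt | hge
  · rw [Nat.mod_eq_of_lt hlt]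
    unfold pairingShift at *
    grind
  · rw [Nat.mod_eq_sub_mod hge, Nat.mod_eq_of_lt (by have := pairingShift_pos_and_lt hh v; lia)]
    unfold pairingShift at *
    grind

/-- The partner of a vertex of the cycle of length `4 * h` in a pairing that merges simply. -/
def partner (h : ℕ) (x : ZMod (4 * h)) : ZMod (4 * h) := x + pairingShift h x.val

theorem val_partner [NeZero h] (x : ZMod (4 * h)) :
    (partner h x).val = (x.val + pairingShift h x.val) % (4 * h) := by
  rw [← ZMod.val_natCast, Nat.cast_add, ZMod.natCast_zmod_val]
  rfl

theorem partner_involutive (hh : 4 ≤ h) : Function.Involutive (partner h) := by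
  have : NeZero h := ⟨by lia⟩
  intro x
  have hcast := congrArg (Nat.cast (R := ZMod (4 * h))) (pairingShift_partner hh x.val_lt)
  rw [← val_partner, Nat.cast_add, ZMod.natCast_self] at hcast
  rw [partner, partner, add_assoc, add_comm _ (pairingShift h _ : ZMod (4 * h))]
  exact add_eq_left.mpr hcast

theorem partner_ne_self (hh : 4 ≤ h) (x : ZMod (4 * h)) : partner h x ≠ x := by
  obtain ⟨hpos, hlt⟩ := pairingShift_pos_and_lt hh x.val
  exact fun heq => natCast_ne_zero_of_lt hpos hlt (add_eq_left.mp heq)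

theorem val_partner_mod_two (hh : 4 ≤ h) (x : ZMod (4 * h)) :
    (partner h x).val % 2 = x.val % 2 := by
  have : NeZero h := ⟨by lia⟩
  rw [val_partner, Nat.mod_mod_of_dvd _ ⟨2 * h, by ring⟩]
  have := even_pairingShift (show 2 ≤ h by lia) x.val
  grind

/-- The partition of the vertices of the cycle of length `4 * h` into pairs of partners. -/
def partnerSetoid (h : ℕ) : Setoid (ZMod (4 * h)) := Setoid.ker fun x => s(x, partner h x)

theorem partnerSetoid_iff (hh : 4 ≤ h) {x y : ZMod (4 * h)} :
    partnerSetoid h x y ↔ y = x ∨ y = partner h x := by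
  have hinv := partner_involutive hh
  refine Sym2.eq_iff.trans ⟨?_, ?_⟩
  · rintro (⟨h, -⟩ | ⟨-, h⟩)
    exacts [.inl h.symm, .inr h.symm]
  · rintro (rfl | rfl)
    exacts [.inl ⟨rfl, rfl⟩, .inr ⟨(hinv x).symm, rfl⟩]

theorem isParityPairing_partnerSetoid (hh : 4 ≤ h) :
    IsParityPairing (4 * h) (partnerSetoid h) := by
  refine ⟨fun x => ?_, fun x y hxy => ?_⟩
  · rw [← Set.ncard_pair (partner_ne_self hh x).symm]
    congr 1 with y
    exact partnerSetoid_iff hh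
  · rcases (partnerSetoid_iff hh).mp hxy with rfl | rfl
    exacts [rfl, (val_partner_mod_two hh x).symm]

theorem IsParityPairing.not_of_adj {n : ℕ} [NeZero n] {P : Setoid (ZMod n)}
    (hP : IsParityPairing n P) (hn : 2 ∣ n) {x y : ZMod n}
    (hadj : (circulant n {1}).graph.Adj x y) : ¬ P x y := fun hxy =>
  (parityColoring hn (by simp)).valid hadj (hP.castHom_eq hn hxy)

theorem eq_zero_of_dvd_sub_sub {d d' k : ℤ} (hh : 4 ≤ h) (hd : d = 0 ∨ d = 2 * h)
    (hd' : d' = 0 ∨ d' = 4 ∨ d' = 2 * h - 4 ∨ d' = 2 * h + 4 ∨ d' = 4 * h - 4)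
    (hk : k = 0 ∨ k = 2 ∨ k = -2) (hdvd : (4 * h : ℤ) ∣ d' - d - k) : d = 0 ∧ d' = 0 := by
  have hzero := Int.eq_zero_of_abs_lt_dvd hdvd (by grind)
  grind

theorem exists_shift_of_partnerSetoid (hh : 4 ≤ h) {x y : ZMod (4 * h)}
    (hxy : partnerSetoid h x y) : ∃ d : ℤ, y = x + d ∧ (d = 0 ∨ d = pairingShift h x.val) := by
  rcases (partnerSetoid_iff hh).mp hxy with rfl | rfl
  · exact ⟨0, by simp, .inl rfl⟩
  · exact ⟨pairingShift h x.val, by simp [partner], .inr rfl⟩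

theorem eq_of_partnerSetoid (hh : 4 ≤ h) {u v u' v' : ZMod (4 * h)} {k k' : ℤ}
    (hk : k = 1 ∨ k = -1) (hk' : k' = 1 ∨ k' = -1) (hv : v = u + k) (hv' : v' = u' + k')
    (hu_even : Even u.val) (hv_odd : Odd v.val) (hu : partnerSetoid h u u')
    (hvv : partnerSetoid h v v') : u = u' ∧ v = v' := by
  obtain ⟨d, hd_eq, hd⟩ := exists_shift_of_partnerSetoid hh hu
  obtain ⟨d', hd'_eq, hd'⟩ := exists_shift_of_partnerSetoid hh hvv
  have hdvd : (4 * h : ℤ) ∣ d' - d - (k' - k) := by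
    rw [show (4 * h : ℤ) = (4 * h : ℕ) by simp, ← ZMod.intCast_zmod_eq_zero_iff_dvd]
    push_cast
    linear_combination -hd'_eq + hd_eq + hv' - hv
  obtain ⟨rfl, rfl⟩ := eq_zero_of_dvd_sub_sub hh (d := d) (d' := d')
    (by simpa [pairingShift, hu_even] using hd)
    (by rw [pairingShift] at hd'; grind) (by lia) hdvd
  simp [hd_eq, hd'_eq]

theorem exists_even_odd_of_mem_edgeSet {n : ℕ} [NeZero n] (hn : 2 ∣ n) {e : Sym2 (ZMod n)}
    (he : e ∈ (circulant n {1}).graph.edgeSet) : ∃ u v : ZMod n, ∃ k : ℤ, e = s(u, v) ∧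
      v = u + k ∧ (k = 1 ∨ k = -1) ∧ Even u.val ∧ Odd v.val := by
  have hparity (x : ZMod n) : ZMod.castHom hn (ZMod 2) x = x.val := (ZMod.natCast_val x).symm
  induction e with | _ u v
  have hne : ZMod.castHom hn (ZMod 2) u ≠ ZMod.castHom hn (ZMod 2) v :=
    (parityColoring hn (by simp)).valid he
  rw [hparity, hparity, Ne, ZMod.natCast_eq_natCast_iff] at hne
  have hstep : ∃ k : ℤ, v = u + k ∧ (k = 1 ∨ k = -1) := by
    have hadj := (circulant_adj.mp he).2
    simp only [Finset.mem_singleton, exists_eq_left, Nat.cast_one] at hadj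
    rcases hadj with h | h
    · exact ⟨-1, by simp [h], .inr rfl⟩
    · exact ⟨1, by simp [h], .inl rfl⟩
  obtain ⟨k, hv, hk⟩ := hstep
  rcases Nat.even_or_odd u.val with hu_even | hu_odd
  · exact ⟨u, v, k, rfl, hv, hk, hu_even, by unfold Nat.ModEq at hne; grind⟩
  · exact ⟨v, u, -k, Sym2.eq_swap, by simp [hv], by lia, by unfold Nat.ModEq at hne; grind, hu_odd⟩

theorem mergesSimply_partnerSetoid (hh : 4 ≤ h) : MergesSimply (4 * h) (partnerSetoid h) := by
  have : NeZero h := ⟨by lia⟩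
  have hn : 2 ∣ 4 * h := ⟨2 * h, by ring⟩
  have hP := isParityPairing_partnerSetoid hh
  refine ⟨fun x y hadj => hP.not_of_adj hn hadj, fun e he e' he' heq => ?_⟩
  obtain ⟨u, v, k, rfl, hv, hk, hu_even, hv_odd⟩ := exists_even_odd_of_mem_edgeSet hn he
  obtain ⟨u', v', k', rfl, hv', hk', hu'_even, hv'_odd⟩ := exists_even_odd_of_mem_edgeSet hn he'
  rcases Sym2.eq_iff.mp heq with ⟨huu, hvv⟩ | ⟨huv, -⟩
  · obtain ⟨rfl, rfl⟩ := eq_of_partnerSetoid hh hk hk' hv hv' hu_even hv_odd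
      (Quotient.exact huu) (Quotient.exact hvv)
    rfl
  · have := hP.2 _ _ (Quotient.exact huv)
    grind

theorem exists_mergesSimply {n : ℕ} (hn : 4 ∣ n) (hn16 : 16 ≤ n) :
    ∃ P : Setoid (ZMod n), IsParityPairing n P ∧ MergesSimply n P := by
  obtain ⟨h, rfl⟩ := hn
  exact ⟨partnerSetoid h, isParityPairing_partnerSetoid (by lia),
    mergesSimply_partnerSetoid (by lia)⟩

end SimpleMerging

theorem TrailCover.ncard_edgeSet {Γ : RootedGraph} {J : Type} [Fintype J] {n : J → ℕ}
    [∀ j, NeZero (n j)] (C : TrailCover Γ n) :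
    Γ.graph.edgeSet.ncard = (∑ j, ({n j} : Multiset ℕ)).sum := by
  rw [C.toTraversal.ncard_edgeSet, Nat.card_sigma, ← Multiset.coe_sumAddMonoidHom, map_sum]
  simp

theorem HasTrailCover.finite_connected_bipartite_regular {Γ : RootedGraph} {p : ℕ} {L : Multiset ℕ}
    (hΓ : HasTrailCover Γ p L) (hp : p ≠ 0) :
    Finite Γ.V ∧ Γ.graph.Connected ∧ Γ.graph.IsBipartite ∧
      ∀ v, (Γ.graph.neighborSet v).ncard = 2 * p := by
  obtain ⟨hbip, J, _, n, C, _, -, hvisits⟩ := hΓ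
  have hC (v : Γ.V) : C.visits v ≠ 0 := hvisits v ▸ hp
  refine ⟨C.finite hC, C.connected hC, hbip, fun v => ?_⟩
  rw [C.toTraversal.ncard_neighborSet, C.visits_toTraversal, hvisits]

section Union

variable {B : Type} {H : B → RootedGraph} {p : ℕ} {L : B → Multiset ℕ}
  (hH : ∀ b, HasTrailCover (H b) p (L b))

include hH

theorem exists_trailCover_onePointUnion [Fintype B] :
    ∃ (J : Type) (_ : Fintype J) (n : J → ℕ) (C : TrailCover (onePointUnion H) n),
      (∀ j, NeZero (n j)) ∧ ∑ j, {n j} = ∑ b, L b ∧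
        (∀ v ≠ (onePointUnion H).root, C.visits v = p) ∧
        C.visits (onePointUnion H).root = Fintype.card B * p := by
  choose _ J _ n C _ hL hvisits using hH
  refine ⟨_, inferInstance, _, TrailCover.onePointUnion C, fun t => inferInstance, ?_, ?_, ?_⟩
  · rw [Fintype.sum_sigma]
    exact Finset.sum_congr rfl fun b _ => hL b
  · rintro (_ | ⟨b, v, hv⟩) hne
    · exact absurd rfl hne
    · exact (TrailCover.visits_onePointUnion_some C hv).trans (hvisits b v)
  · rw [TrailCover.visits_onePointUnion_root]
    simp [hvisits]

theorem sum_le_ncard_edgeSet_onePointUnion [Finite B] (b : B) :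
    (L b).sum ≤ (onePointUnion H).graph.edgeSet.ncard := by
  have := Fintype.ofFinite B
  obtain ⟨J, _, n, C, _, hL, -⟩ := exists_trailCover_onePointUnion hH
  rw [C.ncard_edgeSet, hL, ← Multiset.coe_sumAddMonoidHom, map_sum]
  exact Finset.single_le_sum_of_canonicallyOrdered (f := fun b => (L b).sum) (Finset.mem_univ b)

theorem hasChiLaTwo_onePointUnion [Fintype B] [Nonempty B] (hp : p ≠ 0)
    (hcard : Fintype.card B * p + 1 = p + (∑ b, L b).card) (hL : IsTwoSumLabelable (∑ b, L b)) :
    HasChiLaTwo (onePointUnion H) := by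
  obtain ⟨J, _, n, C, _, hn, hvisits, hroot⟩ := exists_trailCover_onePointUnion hH
  have hC (v) : C.visits v ≠ 0 := by
    by_cases hv : v = (onePointUnion H).root
    · rw [hv, hroot]
      exact mul_ne_zero Fintype.card_ne_zero hp
    · exact hvisits v hv ▸ hp
  have : Nonempty J := let ⟨j, _⟩ := C.exists_walk_eq (hC (onePointUnion H).root); ⟨j⟩
  have hJ : (∑ b, L b).card = Fintype.card J := by simp [← hn]
  obtain ⟨l, x, y, hl⟩ := (hn ▸ hL).exists_isTwoSumLabeling
  exact ⟨C.finite hC, C.connected hC, C.chiLa_eq_two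
    (isBipartite_onePointUnion fun b => (hH b).1) hp hvisits (by rw [hroot, hcard, hJ]) hl⟩

theorem isRegularUnion_onePointUnion [Finite B] [Nontrivial B] (hp : p ≠ 0) {c : ℕ}
    (hc : {b | ¬IsCirculant (H b).graph}.ncard ≤ c) :
    IsRegularUnion (2 * p) c (onePointUnion H) :=
  ⟨B, H, inferInstance, inferInstance, fun b => (hH b).finite_connected_bipartite_regular hp, hc,
    ⟨SimpleGraph.Iso.refl⟩⟩

end Union

theorem ncard_setOf_not_isCirculant_le {B : Type} {H : Option B → RootedGraph} {c : ℕ}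
    (hsome : ∀ b, IsCirculant (H (some b)).graph) (hnone : c = 0 → IsCirculant (H none).graph) :
    {b | ¬IsCirculant (H b).graph}.ncard ≤ c := by
  have hsub : {b | ¬IsCirculant (H b).graph} ⊆ {none} := by
    rintro (_ | b) hb
    · rfl
    · exact absurd (hsome b) hb
  rcases Nat.eq_zero_or_pos c with rfl | hc
  · have hempty : {b | ¬IsCirculant (H b).graph} = ∅ := by
      refine Set.eq_empty_of_forall_notMem fun b hb => hb ?_
      rw [hsub hb]
      exact hnone rfl
    rw [hempty, Set.ncard_empty]
  · exact (Set.ncard_le_ncard hsub).trans ((Set.ncard_singleton _).le.trans hc)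

section Blocks

variable {p q r c : ℕ} {G K : RootedGraph}

theorem onePointUnion_of_long_trails (hp : p ≠ 0) (hq : q ≠ 0) (hqp : q * p + 1 = r)
    (hK : HasTrailCover K p {2 * r - 2}) (hc : c = 0 → IsCirculant K.graph)
    {S : Fin q → Finset ℕ} (hS : ∀ h, IsJumpSet (4 * r - 2) p (S h))
    (hG : G = onePointUnion fun i : Option (Fin q) =>
      i.elim K fun h => circulant (4 * r - 2) (S h)) :
    HasChiLaTwo G ∧ IsRegularUnion (2 * p) c G ∧ r ≤ G.graph.edgeSet.ncard := by
  subst hG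
  obtain ⟨v, hv⟩ := Nat.exists_eq_add_one_of_ne_zero (mul_ne_zero hq hp)
  have : NeZero q := ⟨hq⟩
  have : NeZero (4 * r - 2) := ⟨by lia⟩
  have hH (b : Option (Fin q)) : HasTrailCover (b.elim K fun h => circulant (4 * r - 2) (S h)) p
      (b.elim {2 * r - 2} fun _ => p • {4 * r - 2}) := by
    cases b with
    | none => exact hK
    | some h => exact (hS h).hasTrailCover (by lia)
  have hL : ∑ b : Option (Fin q), b.elim {2 * r - 2} (fun _ => p • ({4 * r - 2} : Multiset ℕ)) =
      (v + 1) • {4 * v + 6} + {2 * v + 2} := by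
    rw [Fintype.sum_option, add_comm, ← hv, mul_smul, show 4 * v + 6 = 4 * r - 2 by lia,
      show 2 * v + 2 = 2 * r - 2 by lia]
    simp
  refine ⟨hasChiLaTwo_onePointUnion hH hp ?_ (hL ▸ isTwoSumLabelable_of_long_trails v),
    isRegularUnion_onePointUnion hH hp
      (ncard_setOf_not_isCirculant_le (fun _ => isCirculant_circulant) hc),
    le_trans ?_ (sum_le_ncard_edgeSet_onePointUnion hH none)⟩
  · simp [hL, add_mul, ← hv]
    lia
  · simp only [Option.elim_none, Multiset.sum_singleton]
    lia

theorem onePointUnion_of_short_trails (hp : p ≠ 0) (hq : q ≠ 0) (hqp : 2 * (q * p) + 1 = r)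
    (hK : HasTrailCover K p {2 * r - 2}) (hc : c = 0 → IsCirculant K.graph)
    {S T : Fin q → Finset ℕ} (hS : ∀ h, IsJumpSet (2 * r) p (S h))
    (hT : ∀ h, IsJumpSet (2 * r - 2) p (T h))
    (hG : G = onePointUnion fun i : Option (Fin q ⊕ Fin q) => i.elim K
      (Sum.elim (fun h => circulant (2 * r) (S h)) fun h => circulant (2 * r - 2) (T h))) :
    HasChiLaTwo G ∧ IsRegularUnion (2 * p) c G ∧ r ≤ G.graph.edgeSet.ncard := by
  subst hG
  have hqp0 := mul_ne_zero hq hp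
  have : NeZero q := ⟨hq⟩
  have : NeZero (2 * r) := ⟨by lia⟩
  have : NeZero (2 * r - 2) := ⟨by lia⟩
  have hH (b : Option (Fin q ⊕ Fin q)) : HasTrailCover (b.elim K
      (Sum.elim (fun h => circulant (2 * r) (S h)) fun h => circulant (2 * r - 2) (T h))) p
      (b.elim {2 * r - 2} (Sum.elim (fun _ => p • {2 * r}) fun _ => p • {2 * r - 2})) := by
    rcases b with _ | h | h
    · exact hK
    · exact (hS h).hasTrailCover (by lia)
    · exact (hT h).hasTrailCover (by lia)
  have hL : ∑ b : Option (Fin q ⊕ Fin q), b.elim {2 * r - 2}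
      (Sum.elim (fun _ => p • {2 * r}) fun _ => p • ({2 * r - 2} : Multiset ℕ)) =
      (q * p) • {4 * (q * p) + 2} + (q * p + 1) • {4 * (q * p)} := by
    rw [Fintype.sum_option, show 4 * (q * p) + 2 = 2 * r by lia,
      show 4 * (q * p) = 2 * r - 2 by lia]
    simp only [Fintype.sum_sum_type, Option.elim_none, Option.elim_some, Sum.elim_inl,
      Sum.elim_inr, Finset.sum_const, Finset.card_univ, Fintype.card_fin, mul_smul, succ_nsmul]
    abel
  refine ⟨hasChiLaTwo_onePointUnion hH hp ?_ (hL ▸ isTwoSumLabelable_of_short_trails hqp0),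
    isRegularUnion_onePointUnion hH hp (ncard_setOf_not_isCirculant_le ?_ hc),
    le_trans ?_ (sum_le_ncard_edgeSet_onePointUnion hH none)⟩
  · simp [hL, add_mul]
    lia
  · rintro (h | h)
    · exact isCirculant_circulant (m := 2 * r)
    · exact isCirculant_circulant (m := 2 * r - 2)
  · simp only [Option.elim_none, Multiset.sum_singleton]
    lia

end Blocks

section JumpSets

theorem isJumpSet_pair {m a : ℕ} (h1 : 1 < a) (h2 : 2 * a < m) (ha : a.Coprime m) :
    IsJumpSet m 2 {1, a} := by
  refine ⟨Finset.card_pair h1.ne, by simp, ?_⟩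
  simp only [Finset.mem_insert, Finset.mem_singleton, forall_eq_or_imp, forall_eq]
  exact ⟨⟨by lia, Nat.coprime_one_left m⟩, h2, ha⟩

theorem coprime_two_mul_of_odd {a m : ℕ} (ha : Odd a) (h : a.Coprime m) : a.Coprime (2 * m) :=
  Nat.Coprime.mul_right (Nat.coprime_two_right.mpr ha) h

theorem coprime_sub_two_pow_two_mul {q i : ℕ} (hq : Odd q) (hi : i ≠ 0) (h : 2 ^ i ≤ q) :
    (q - 2 ^ i).Coprime (2 * q) := by
  refine coprime_two_mul_of_odd (Nat.Odd.sub_even h hq (Nat.even_pow.mpr ⟨even_two, hi⟩)) ?_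
  rw [Nat.coprime_self_sub_left h]
  exact Nat.Coprime.pow_left _ (Nat.coprime_two_left.mpr hq)

theorem exists_isJumpSet_two_mul_odd {q u : ℕ} (hq : Odd q) (hu : 2 ^ u + 1 < q) :
    ∃ S, IsJumpSet (2 * q) (u + 1) S := by
  have hpow (i : ℕ) (hi : i ∈ Finset.range u) : 2 ^ (i + 1) ≤ 2 ^ u :=
    Nat.pow_le_pow_right two_pos (Finset.mem_range.mp hi)
  have hinj : Set.InjOn (fun i => q - 2 ^ (i + 1)) (Finset.range u) := fun i hi j hj hij => by
    have hi' := hpow i hi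
    have hj' := hpow j hj
    have hij' : 2 ^ (i + 1) = 2 ^ (j + 1) := by simp only at hij; lia
    exact Nat.succ_injective (Nat.pow_right_injective le_rfl hij')
  have hone : 1 ∉ (Finset.range u).image fun i => q - 2 ^ (i + 1) := fun h => by
    obtain ⟨i, hi, h⟩ := Finset.mem_image.mp h
    have := hpow i hi
    lia
  refine ⟨insert 1 ((Finset.range u).image fun i => q - 2 ^ (i + 1)), ?_, by simp, ?_⟩
  · rw [Finset.card_insert_of_notMem hone, Finset.card_image_of_injOn hinj, Finset.card_range]
  · simp only [Finset.forall_mem_insert, Finset.forall_mem_image]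
    refine ⟨⟨by lia, Nat.coprime_one_left _⟩, fun i hi => ⟨?_, ?_⟩⟩
    · have := Nat.two_pow_pos (i + 1)
      lia
    · exact coprime_sub_two_pow_two_mul hq i.succ_ne_zero (by have := hpow i hi; lia)

theorem exists_isJumpSet_two_pow {e p : ℕ} (hp : p ≠ 0) (he : 4 * p ≤ 2 ^ e) :
    ∃ S, IsJumpSet (2 ^ e) p S := by
  refine ⟨(Finset.range p).image fun i => 2 * i + 1, ?_, ?_, ?_⟩
  · rw [Finset.card_image_of_injective _ fun i j h => by lia, Finset.card_range]
  · exact Finset.mem_image.mpr ⟨0, Finset.mem_range.mpr (Nat.pos_of_ne_zero hp), rfl⟩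
  · simp only [Finset.forall_mem_image, Finset.mem_range]
    intro i hi
    exact ⟨by lia, Nat.Coprime.pow_right _ (Nat.coprime_two_right.mpr ⟨i, rfl⟩)⟩

end JumpSets

theorem infinitelyMany_of_forall_exists_le_ncard_edgeSet {F : Set RootedGraph}
    (hF : ∀ N, ∃ G ∈ F, N ≤ G.graph.edgeSet.ncard) : InfinitelyMany F := by
  have hinf : ((fun G : RootedGraph => G.graph.edgeSet.ncard) '' F).Infinite := by
    refine Set.infinite_of_forall_exists_gt fun N => ?_
    obtain ⟨G, hG, hN⟩ := hF (N + 1)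
    exact ⟨_, ⟨G, hG, rfl⟩, hN⟩
  choose G hG hcard using fun k => (hinf.natEmbedding _ k).2
  refine ⟨G, hG, fun i j hij => ⟨fun e => hij ((hinf.natEmbedding _).injective ?_)⟩⟩
  rw [Subtype.ext_iff, ← hcard, ← hcard]
  exact Nat.card_congr e.mapEdgeSet

section Families

variable {s t r e : ℕ} {G : RootedGraph}

theorem familyA_properties (hodd : Odd r) (hr : 9 ≤ r) (hG : G ∈ familyA r) :
    HasChiLaTwo G ∧ IsRegularUnion 4 1 G ∧ r ≤ G.graph.edgeSet.ncard := by
  obtain ⟨a, P, ha, hP, hsimple, rfl⟩ := hG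
  exact onePointUnion_of_long_trails (p := 2) two_ne_zero (by lia) (by grind)
    (hasTrailCover_mergedCycle (by lia) (by lia) hP hsimple) (by simp)
    (fun h => isJumpSet_pair (ha h).1 (by have := ha h; lia) (ha h).2.2) rfl

theorem familyB_properties (hmod : r % 4 = 1) (hr : 9 ≤ r) (hG : G ∈ familyB r) :
    HasChiLaTwo G ∧ IsRegularUnion 4 1 G ∧ r ≤ G.graph.edgeSet.ncard := by
  obtain ⟨a, b, P, ha, hb, hP, hsimple, rfl⟩ := hG
  exact onePointUnion_of_short_trails (p := 2) two_ne_zero (by lia) (by lia)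
    (hasTrailCover_mergedCycle (by lia) (by lia) hP hsimple) (by simp)
    (fun h => isJumpSet_pair (ha h).1 (by have := ha h; lia) (ha h).2.2)
    (fun h => isJumpSet_pair (hb h).1 (by have := hb h; lia) (hb h).2.2) rfl

theorem familyC_properties (hs : 2 ≤ s) (hG : G ∈ familyC s t r) :
    HasChiLaTwo G ∧ IsRegularUnion (2 ^ s) 0 G ∧ r ≤ G.graph.edgeSet.ncard := by
  obtain ⟨hr, S, hS, hG⟩ := hG
  have hlength : 2 * r - 2 = 2 * (2 ^ (2 * s - 2) * (t + 2)) := by lia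
  have hsq : 2 ^ (2 * s - 2) = 2 ^ (s - 1) * 2 ^ (s - 1) := by
    rw [← pow_add, show s - 1 + (s - 1) = 2 * s - 2 by lia]
  have : NeZero (2 ^ s * (t + 2)) := ⟨by positivity⟩
  have h := onePointUnion_of_long_trails (c := 0) (Nat.two_pow_pos (s - 1)).ne' (by positivity)
    (by rw [hr, hsq]; ring) (hlength ▸ hasTrailCover_circulant_jumps hs)
    (fun _ => isCirculant_circulant) hS hG
  rwa [mul_pow_sub_one (by lia)] at h

theorem familyD_properties (hs : 2 ≤ s) (hG : G ∈ familyD s t r) :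
    HasChiLaTwo G ∧ IsRegularUnion (2 ^ s) 0 G ∧ r ≤ G.graph.edgeSet.ncard := by
  obtain ⟨hr, S, T, hS, hT, hG⟩ := hG
  have hlength : 2 * r - 2 = 2 * (2 ^ (2 * s - 2) * (t + 2)) := by lia
  have hsplit : 2 ^ (2 * s - 2) = 2 * (2 ^ (s - 2) * 2 ^ (s - 1)) := by
    rw [← pow_add, ← pow_succ', show s - 2 + (s - 1) + 1 = 2 * s - 2 by lia]
  have : NeZero (2 ^ s * (t + 2)) := ⟨by positivity⟩
  have h := onePointUnion_of_short_trails (c := 0) (Nat.two_pow_pos (s - 1)).ne' (by positivity)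
    (by rw [hr, hsplit]; ring) (hlength ▸ hasTrailCover_circulant_jumps hs)
    (fun _ => isCirculant_circulant) hS hT hG
  rwa [mul_pow_sub_one (by lia)] at h

theorem familyA_nonempty (hodd : Odd r) (hr : 9 ≤ r) : (familyA r).Nonempty := by
  obtain ⟨P, hP, hsimple⟩ := exists_mergesSimply (n := 2 * r - 2) (by grind) (by lia)
  have ha : (2 * r - 1 - 2).Coprime (2 * (2 * r - 1)) :=
    coprime_sub_two_pow_two_mul ⟨r - 1, by lia⟩ one_ne_zero (by lia)
  rw [show 2 * (2 * r - 1) = 4 * r - 2 by lia] at ha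
  exact ⟨_, fun _ => 2 * r - 1 - 2, P, fun _ => ⟨by lia, by lia, ha⟩, hP, hsimple, rfl⟩

theorem familyB_nonempty (hmod : r % 4 = 1) (hr : 9 ≤ r) : (familyB r).Nonempty := by
  obtain ⟨P, hP, hsimple⟩ := exists_mergesSimply (n := 2 * r - 2) (by lia) (by lia)
  have ha : (r - 2).Coprime (2 * r) :=
    coprime_sub_two_pow_two_mul ⟨r / 2, by lia⟩ one_ne_zero (by lia)
  have hb : (r - 2).Coprime (2 * (r - 2 + 1)) :=
    coprime_two_mul_of_odd ⟨r / 2 - 1, by lia⟩ (by simp)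
  rw [show 2 * (r - 2 + 1) = 2 * r - 2 by lia] at hb
  exact ⟨_, fun _ => r - 2, fun _ => r - 2, P, fun _ => ⟨by lia, by lia, ha⟩,
    fun _ => ⟨by lia, by lia, hb⟩, hP, hsimple, rfl⟩

theorem exists_two_pow_eq_mul (he : 2 * s - 2 < e) :
    ∃ t, 2 ^ e = 2 ^ (2 * s - 2) * (t + 2) := by
  obtain ⟨k, rfl⟩ := Nat.exists_eq_add_of_lt he
  refine ⟨2 ^ (k + 1) - 2, ?_⟩
  rw [Nat.sub_add_cancel (Nat.le_self_pow k.succ_ne_zero 2), ← pow_add, add_assoc]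

theorem two_pow_pred_lt (he : 2 ^ (s - 1) ≤ e) : 2 ^ (2 ^ (s - 1) - 1) < 2 ^ e :=
  Nat.pow_lt_pow_right one_lt_two (by have := Nat.two_pow_pos (s - 1); lia)

theorem familyC_nonempty (hse : 2 * s - 2 < e) (he : 2 ^ (s - 1) ≤ e) :
    ∃ t, (familyC s t (2 ^ e + 1)).Nonempty := by
  obtain ⟨t, ht⟩ := exists_two_pow_eq_mul hse
  have hlt := two_pow_pred_lt he
  obtain ⟨S, hS⟩ := exists_isJumpSet_two_mul_odd (q := 2 * 2 ^ e + 1) (u := 2 ^ (s - 1) - 1)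
    ⟨2 ^ e, rfl⟩ (by lia)
  rw [Nat.sub_add_cancel Nat.one_le_two_pow,
    show 2 * (2 * 2 ^ e + 1) = 4 * (2 ^ e + 1) - 2 by lia] at hS
  exact ⟨t, _, by rw [ht], fun _ => S, fun _ => hS, rfl⟩

theorem familyD_nonempty (hse : 2 * s - 2 < e) (he : 2 ^ (s - 1) ≤ e) :
    ∃ t, (familyD s t (2 ^ e + 1)).Nonempty := by
  obtain ⟨t, ht⟩ := exists_two_pow_eq_mul hse
  have hodd : Odd (2 ^ e + 1) := Even.add_one (Nat.even_pow.mpr ⟨even_two, by lia⟩)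
  obtain ⟨S, hS⟩ := exists_isJumpSet_two_mul_odd hodd (Nat.succ_lt_succ (two_pow_pred_lt he))
  rw [Nat.sub_add_cancel Nat.one_le_two_pow] at hS
  have hle : 4 * 2 ^ (s - 1) ≤ 2 ^ (e + 1) := by
    have := (s - 1).lt_two_pow_self
    rw [show 4 * 2 ^ (s - 1) = 2 ^ (s - 1 + 2) by ring]
    exact Nat.pow_le_pow_right two_pos (by lia)
  obtain ⟨T, hT⟩ := exists_isJumpSet_two_pow (Nat.two_pow_pos (s - 1)).ne' hle
  rw [show 2 ^ (e + 1) = 2 * (2 ^ e + 1) - 2 by rw [pow_succ']; lia] at hT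
  exact ⟨t, _, by rw [ht], fun _ => S, fun _ => T, fun _ => hS, fun _ => hT, rfl⟩

end Families

theorem infinitelyMany_familyA : InfinitelyMany {G | ∃ r : ℕ, Odd r ∧ 9 ≤ r ∧ G ∈ familyA r} := by
  refine infinitelyMany_of_forall_exists_le_ncard_edgeSet fun N => ?_
  have hodd : Odd (2 * N + 9) := ⟨N + 4, by ring⟩
  obtain ⟨G, hG⟩ := familyA_nonempty hodd (by lia)
  exact ⟨G, ⟨_, hodd, by lia, hG⟩, le_trans (by lia) (familyA_properties hodd (by lia) hG).2.2⟩

theorem infinitelyMany_familyB :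
    InfinitelyMany {G | ∃ r : ℕ, r % 4 = 1 ∧ 9 ≤ r ∧ G ∈ familyB r} := by
  refine infinitelyMany_of_forall_exists_le_ncard_edgeSet fun N => ?_
  have hmod : (4 * N + 9) % 4 = 1 := by lia
  obtain ⟨G, hG⟩ := familyB_nonempty hmod (by lia)
  exact ⟨G, ⟨_, hmod, by lia, hG⟩, le_trans (by lia) (familyB_properties hmod (by lia) hG).2.2⟩

theorem le_two_pow_add_one (N c : ℕ) : N ≤ 2 ^ (N + c) + 1 :=
  (Nat.le_add_right N c).trans (Nat.lt_two_pow_self.le.trans (Nat.le_succ _))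

theorem infinitelyMany_familyC {s : ℕ} (hs : 2 ≤ s) :
    InfinitelyMany {G | ∃ t r : ℕ, G ∈ familyC s t r} := by
  refine infinitelyMany_of_forall_exists_le_ncard_edgeSet fun N => ?_
  obtain ⟨t, G, hG⟩ := familyC_nonempty (s := s) (e := N + (2 * s + 2 ^ (s - 1))) (by lia) (by lia)
  exact ⟨G, ⟨t, _, hG⟩, (le_two_pow_add_one N _).trans (familyC_properties hs hG).2.2⟩

theorem infinitelyMany_familyD {s : ℕ} (hs : 2 ≤ s) :
    InfinitelyMany {G | ∃ t r : ℕ, G ∈ familyD s t r} := by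
  refine infinitelyMany_of_forall_exists_le_ncard_edgeSet fun N => ?_
  obtain ⟨t, G, hG⟩ := familyD_nonempty (s := s) (e := N + (2 * s + 2 ^ (s - 1))) (by lia) (by lia)
  exact ⟨G, ⟨t, _, hG⟩, (le_two_pow_add_one N _).trans (familyD_properties hs hG).2.2⟩

end LocalAntimagic

open LocalAntimagic

theorem mainTheorem11 :
    -- every transformed graph is a one-point union of regular graphs with `χ_la = 2`
    (∀ r : ℕ, Odd r → 9 ≤ r → ∀ G ∈ familyA r, HasChiLaTwo G ∧ IsRegularUnion 4 1 G) ∧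
    (∀ r : ℕ, r % 4 = 1 → 9 ≤ r → ∀ G ∈ familyB r, HasChiLaTwo G ∧ IsRegularUnion 4 1 G) ∧
    (∀ s t r : ℕ, 2 ≤ s → ∀ G ∈ familyC s t r,
      HasChiLaTwo G ∧ IsRegularUnion (2 ^ s) 0 G) ∧
    (∀ s t r : ℕ, 2 ≤ s → ∀ G ∈ familyD s t r,
      HasChiLaTwo G ∧ IsRegularUnion (2 ^ s) 0 G) ∧
    -- the transformations are possible, and yield infinitely many graphs
    (∀ r : ℕ, Odd r → 9 ≤ r → (familyA r).Nonempty) ∧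
    (∀ r : ℕ, r % 4 = 1 → 9 ≤ r → (familyB r).Nonempty) ∧
    InfinitelyMany {G | ∃ r : ℕ, Odd r ∧ 9 ≤ r ∧ G ∈ familyA r} ∧
    InfinitelyMany {G | ∃ r : ℕ, r % 4 = 1 ∧ 9 ≤ r ∧ G ∈ familyB r} ∧
    (∀ s : ℕ, 2 ≤ s → InfinitelyMany {G | ∃ t r : ℕ, G ∈ familyC s t r}) ∧
    (∀ s : ℕ, 2 ≤ s → InfinitelyMany {G | ∃ t r : ℕ, G ∈ familyD s t r}) := by
  refine ⟨fun r hodd hr G hG => ?_, fun r hmod hr G hG => ?_, fun s t r hs G hG => ?_,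
    fun s t r hs G hG => ?_, fun _ => familyA_nonempty, fun _ => familyB_nonempty,
    infinitelyMany_familyA, infinitelyMany_familyB, fun _ => infinitelyMany_familyC,
    fun _ => infinitelyMany_familyD⟩
  · exact (familyA_properties hodd hr hG).imp_right And.left
  · exact (familyB_properties hmod hr hG).imp_right And.left
  · exact (familyC_properties hs hG).imp_right And.left
  · exact (familyD_properties hs hG).imp_right And.left
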